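/- Let $n\ge 1$, $\alpha\ge 0$ and $\Gamma_\alpha=\{\lambda\in\mathbb R^n:\lambda_k>\alpha \text{ for all } k\}$. Let $f:\Gamma_\alpha\to\mathbb R$ be smooth, symmetric (invariant under permutations of the arguments), monotone (nondecreasing in each argument), concave and inverse-concave. The last condition means that for some $\sigma\in[0,\alpha]$ the function $\kappa\mapsto -f(\sigma+\kappa_1^{-1},\dots,\sigma+\kappa_n^{-1})$ is concave on the set of all $\kappa$ with $\kappa_i>0$ and $\sigma+\kappa_i^{-1}>\alpha$ for all $i$. (For $\sigma=0$ this is inverse concavity of $f$ itself; for $\sigma=\alpha$ it is inverse concavity of $\tilde f$ on the positive cone, where $f(\lambda)=\tilde f(\lambda_1-\alpha,\dots,\lambda_n-\alpha)$.) For a symmetric real $n\times n$ matrix $A$ with eigenvalues $\lambda(A)\in\Gamma_\alpha$ put $F(A)=f(\lambda(A))$, and let $F^{kl}(A)$ and $F^{kl,pq}(A)$ be the components of the first and second derivatives of $F$ on the space of symmetric matrices, i.e. $DF(A)[B]=F^{kl}(A)B_{kl}$ and $D^2F(A)[B,C]=F^{kl,pq}(A)B_{kl}C_{pq}$ for symmetric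 $B,C$, with $F^{kl}$ symmetric in $(k,l)$ and $F^{kl,pq}$ symmetric in $(k,l)$ and in $(p,q)$. Repeated indices are summed from $1$ to $n$, and indices are raised and lowered with $\delta_{ij}$. Let $A$ be a symmetric matrix with eigenvalues in $\Gamma_\alpha$ and $v\neq 0$ an eigenvector of $A$ for its smallest eigenvalue. Let $\tilde A=A-\alpha I$ and $$\epsilon=\frac{\tilde A_{ij}v^iv^j}{\operatorname{tr}\tilde A\,|v|^2}.$$ Then $\epsilon\in(0,\tfrac1n]$, and $\epsilon=\tfrac1n$ only if $A$ is a multiple of the identity. If $T$ is a totally symmetric $3$-tensor with $T_{ijk}v^iv^j=\epsilon\,\delta^{ij}T_{ijk}$ for $k=1,\dots,n$, then $$\begin{aligned}\beta:={}&v^iv^jF^{kl,pq}(A)T_{ikl}T_{jpq}-\epsilon|v|^2\delta^{ab}F^{kl,pq}(A)T_{akl}T_{bpq}\\&+2\sup_{\Gamma}F^{kl}(A)\Big(2\Gamma^p_k\big(T_{lpi}v^i-\epsilon\,\delta^{ab}T_{lab}v_p\big)-\Gamma^p_k\Gamma^q_l\big(\tilde A_{pq}-\epsilon\operatorname{tr}\tilde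 A\,\delta_{pq}\big)\Big)\ \ge 0,\end{aligned}$$ where the supremum is over all real arrays $(\Gamma^p_k)_{1\le k,p\le n}$ and takes values in $(-\infty,+\infty]$. -/

import Mathlib

open scoped ContDiff Matrix

/- The entrywise sup norm on matrices; it is only used to speak of derivatives on the
finite-dimensional space of symmetric matrices, where the choice of the norm is immaterial. -/
attribute [local instance] Matrix.normedAddCommGroup Matrix.normedSpace

noncomputable section

namespace CurvaturePinching

/-- `Γ_α`: the vectors all of whose components are larger than `α`. -/
def Gam (n : ℕ) (α : ℝ) : Set (Fin n → ℝ) := {κ | ∀ i, α < κ i}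

/-- `f` is invariant under permutations of its arguments on `Γ_α`. -/
def SymmetricOn {n : ℕ} (α : ℝ) (f : (Fin n → ℝ) → ℝ) : Prop :=
  ∀ κ ∈ Gam n α, ∀ π : Equiv.Perm (Fin n), f (κ ∘ π) = f κ

/-- Inverse concavity of a function `f` on `Γ_α`, with respect to the base point `σ`:
the function `κ ↦ -f(σ + 1/κ₁, …, σ + 1/κₙ)` is concave, on all the positive `κ` for which the
argument of `f` lies in `Γ_α`. For `σ = 0` this is inverse concavity of `f` itself; in general it is
inverse concavity of `g`, where `f (κ) = g (κ - σ e)` and `e = (1, …, 1)`. -/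
def InverseConcaveOn {n : ℕ} (α σ : ℝ) (f : (Fin n → ℝ) → ℝ) : Prop :=
  ConcaveOn ℝ {κ : Fin n → ℝ | (∀ i, 0 < κ i) ∧ (fun i => σ + (κ i)⁻¹) ∈ Gam n α}
    (fun κ => -f (fun i => σ + (κ i)⁻¹))

/-- The space of symmetric real `n × n` matrices. -/
def SymMat (n : ℕ) : Submodule ℝ (Matrix (Fin n) (Fin n) ℝ) where
  carrier := {A | Aᵀ = A}
  add_mem' := by
    intro A B hA hB
    simp only [Set.mem_ofPred_eq] at hA hB ⊢
    rw [Matrix.transpose_add, hA, hB]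
  zero_mem' := Matrix.transpose_zero
  smul_mem' := by
    intro c A hA
    simp only [Set.mem_ofPred_eq] at hA ⊢
    rw [Matrix.transpose_smul, hA]

theorem SymMat.isHermitian {n : ℕ} (A : SymMat n) :
    (A : Matrix (Fin n) (Fin n) ℝ).IsHermitian := by
  have h : (A : Matrix (Fin n) (Fin n) ℝ)ᵀ = A := A.2
  rw [Matrix.IsHermitian, Matrix.conjTranspose_eq_transpose_of_trivial, h]

/-- The eigenvalues of a symmetric matrix, with multiplicity. -/
def eig {n : ℕ} (A : SymMat n) : Fin n → ℝ := (SymMat.isHermitian A).eigenvalues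

/-- The curvature function `f`, as a function `F` of symmetric matrices. -/
def matFun {n : ℕ} (f : (Fin n → ℝ) → ℝ) (A : SymMat n) : ℝ := f (eig A)

/-- The symmetric matrix `(E_kl + E_lk) / 2`. -/
def symUnit {n : ℕ} (k l : Fin n) : SymMat n :=
  ⟨(1 / 2 : ℝ) • (Matrix.single k l 1 + Matrix.single l k 1), by
    change ((1 / 2 : ℝ) • (Matrix.single k l (1 : ℝ) + Matrix.single l k 1))ᵀ = _
    rw [Matrix.transpose_smul, Matrix.transpose_add, Matrix.transpose_single,
      Matrix.transpose_single, add_comm]⟩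

/-- `F^{kl}(A)`: the components of the first derivative of `F` on the symmetric matrices, so that
`dF(A)[B] = ∑ F^{kl}(A) B_kl` for symmetric `B`, and `F^{kl} = F^{lk}`. -/
def F1 {n : ℕ} (f : (Fin n → ℝ) → ℝ) (A : SymMat n) (k l : Fin n) : ℝ :=
  fderiv ℝ (matFun f) A (symUnit k l)

/-- `F^{kl,pq}(A)`: the components of the second derivative of `F` on the symmetric matrices. -/
def F2 {n : ℕ} (f : (Fin n → ℝ) → ℝ) (A : SymMat n) (k l p q : Fin n) : ℝ :=
  fderiv ℝ (fun X : SymMat n => fderiv ℝ (matFun f) X) A (symUnit k l) (symUnit p q)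

/-- `v` is an eigenvector of `A` for the smallest eigenvalue of `A`. -/
def IsMinEigenvector {n : ℕ} (A : SymMat n) (v : Fin n → ℝ) : Prop :=
  v ≠ 0 ∧ ∃ μ : ℝ, (A : Matrix (Fin n) (Fin n) ℝ) *ᵥ v = μ • v ∧ ∀ i, μ ≤ eig A i

/-- `Ã = A - α I`. -/
def shifted {n : ℕ} (α : ℝ) (A : SymMat n) : Matrix (Fin n) (Fin n) ℝ :=
  (A : Matrix (Fin n) (Fin n) ℝ) - α • (1 : Matrix (Fin n) (Fin n) ℝ)

/-- `ε = Ã_ij vⁱ vʲ / (tr Ã |v|²)`. -/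
def eps {n : ℕ} (α : ℝ) (A : SymMat n) (v : Fin n → ℝ) : ℝ :=
  (∑ i, ∑ j, shifted α A i j * v i * v j) / ((shifted α A).trace * ∑ i, v i ^ 2)

/-- `T` is a totally symmetric 3-tensor. -/
def TotallySymmetric {n : ℕ} (T : Fin n → Fin n → Fin n → ℝ) : Prop :=
  ∀ i j k, T i j k = T j i k ∧ T i j k = T i k j

/-- The expression
`F^{kl}(A) (2 Γᵖ_k (T_lpi vⁱ - ε δ^{ab} T_lab v_p) - Γᵖ_k Γ^q_l (Ã_pq - ε tr Ã δ_pq))`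
under the supremum; `G p k` is `Γᵖ_k`. -/
def gammaTerm {n : ℕ} (α : ℝ) (f : (Fin n → ℝ) → ℝ) (A : SymMat n) (v : Fin n → ℝ)
    (T : Fin n → Fin n → Fin n → ℝ) (G : Fin n → Fin n → ℝ) : ℝ :=
  ∑ k, ∑ l, F1 f A k l *
    (2 * (∑ p, G p k * ((∑ i, T l p i * v i) - eps α A v * (∑ a, T l a a) * v p))
      - ∑ p, ∑ q, G p k * G q l *
          (shifted α A p q
            - eps α A v * (shifted α A).trace * (1 : Matrix (Fin n) (Fin n) ℝ) p q))

/-- The quantity `β`. The supremum runs over all real arrays `Γᵖ_k` and can be `+∞`, so it is taken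
in the extended reals. -/
def beta {n : ℕ} (α : ℝ) (f : (Fin n → ℝ) → ℝ) (A : SymMat n) (v : Fin n → ℝ)
    (T : Fin n → Fin n → Fin n → ℝ) : EReal :=
  (((∑ i, ∑ j, ∑ k, ∑ l, ∑ p, ∑ q, v i * v j * F2 f A k l p q * T i k l * T j p q)
      - eps α A v * (∑ i, v i ^ 2) *
          (∑ a, ∑ k, ∑ l, ∑ p, ∑ q, F2 f A k l p q * T a k l * T a p q) : ℝ) : EReal)
    + 2 * ⨆ G : Fin n → Fin n → ℝ, ((gammaTerm α f A v T G : ℝ) : EReal)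

end CurvaturePinching

end

noncomputable section

namespace CurvaturePinching

open Filter Topology Polynomial Asymptotics

/-! ### Convexity and derivatives -/

/-! Rotate to an eigenbasis of A in which v = ρ e_o. Write x_k = λ_k - α, p_k = ∂_k f, b = T_o and
E_a = 1/(x_a - x_o), read as 0 if x_a = x_o. There D²F(A)[B,B] is Q(B) = ∑ f_kl B_kk B_ll + ∑_{k≠l}
c_kl B_kl², where c_kl = (p_k - p_l)/(λ_k - λ_l), or f_kk - f_kl for equal eigenvalues. After
division by ρ² the claim reads Q(b) - ε ∑_a Q(T_a) + 2 sup ≥ 0.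

Concavity makes both parts of Q nonpositive, so for a ≠ o only the entries oa and ao need to be
kept: Q(T_a) ≤ 2 c_oa b_aa². Inverse concavity bounds Q(b) from below by a form with coefficients
-(p_k/x_l + p_l/x_k). The expression in Γ is unbounded above if its linear part is nonzero on the
kernel of its quadratic part. Otherwise completing the square produces ∑ p_k E_a b_ka². Since E_a ≥
1/x_a and c_oa = -(p_o - p_a) E_a wherever b_ka ≠ 0, this gain absorbs all negative terms except the
one with b_oo². That one is paid for by b_oo = ε ∑ b_kk and Cauchy-Schwarz with weights x. This is
`exists_specGamma_nonneg`, which needs all p_k > 0; if some p_k vanishes, f is constant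
(`eq_of_d1_eq_zero`) and every term is zero.

The formula for D²F is obtained without differentiating eigenvectors. Hermite interpolation gives
polynomial expressions in X that agree with F, respectively DF, to first order at A. The error
depends only on the eigenvalues, up to an orthogonal conjugation with bounded entries, and the
eigenvalues are Lipschitz in X by a Hoffman-Wielandt argument (`IsSpectral.exists_near`). -/

theorem le_add_of_concaveOn_of_hasFDerivAt {E : Type*} [NormedAddCommGroup E] [NormedSpace ℝ E]
    {s : Set E} {f : E → ℝ} {f' : E →L[ℝ] ℝ} {x y : E} (hf : ConcaveOn ℝ s f) (hx : x ∈ s)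
    (hy : y ∈ s) (h : HasFDerivAt f f' x) : f y ≤ f x + f' (y - x) := by
  have hline : HasDerivAt (fun t : ℝ => x + t • (y - x)) (y - x) 0 := by
    simpa using ((hasDerivAt_id (0 : ℝ)).smul_const (y - x)).const_add x
  have hφ : HasDerivAt (fun t : ℝ => f (x + t • (y - x))) (f' (y - x)) 0 := by
    have h0 : HasFDerivAt f f' (x + (0 : ℝ) • (y - x)) := by simpa using h
    exact h0.comp_hasDerivAt 0 hline
  have ht := hφ.tendsto_slope_zero_right
  have hev : ∀ᶠ t : ℝ in 𝓝[>] 0,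
      f y - f x ≤ t⁻¹ • (f (x + (0 + t) • (y - x)) - f (x + (0 : ℝ) • (y - x))) := by
    filter_upwards [Ioo_mem_nhdsGT (zero_lt_one (α := ℝ))] with t ht
    have hc := hf.2 hx hy (sub_nonneg.2 ht.2.le) ht.1.le (by ring)
    have he : (1 - t) • x + t • y = x + t • (y - x) := by module
    rw [he] at hc
    simp only [smul_eq_mul] at hc
    rw [zero_add, zero_smul, add_zero, smul_eq_mul, inv_mul_eq_div, le_div_iff₀ ht.1]
    linarith
  have := ge_of_tendsto ht hev
  linarith

theorem antitone_of_concaveOn_of_hasFDerivAt {E : Type*} [NormedAddCommGroup E] [NormedSpace ℝ E]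
    {s : Set E} {f : E → ℝ} {f' g' : E →L[ℝ] ℝ} {x y : E} (hf : ConcaveOn ℝ s f) (hx : x ∈ s)
    (hy : y ∈ s) (h : HasFDerivAt f f' x) (hg : HasFDerivAt f g' y) :
    g' (y - x) ≤ f' (y - x) := by
  have h1 := le_add_of_concaveOn_of_hasFDerivAt hf hx hy h
  have h2 := le_add_of_concaveOn_of_hasFDerivAt hf hy hx hg
  have h3 : g' (x - y) = - g' (y - x) := by rw [← map_neg, neg_sub]
  linarith

/-- The derivative of a concave function in a fixed direction decreases along that direction. -/
theorem deriv_nonpos_of_concaveOn {E : Type*} [NormedAddCommGroup E] [NormedSpace ℝ E]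
    {s : Set E} {f : E → ℝ} {f' : E → E →L[ℝ] ℝ} {x η : E} {c : ℝ} (hf : ConcaveOn ℝ s f)
    (hs : IsOpen s) (hx : x ∈ s) (h : ∀ y ∈ s, HasFDerivAt f (f' y) y)
    (hc : HasDerivAt (fun t : ℝ => f' (x + t • η) η) c 0) : c ≤ 0 := by
  have ht := hc.tendsto_slope_zero_right
  refine le_of_tendsto ht ?_
  have hcont : Tendsto (fun t : ℝ => x + t • η) (𝓝[>] 0) (𝓝 x) := by
    have : Continuous (fun t : ℝ => x + t • η) := by fun_prop
    have h0 := this.tendsto 0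
    rw [zero_smul, add_zero] at h0
    exact h0.mono_left nhdsWithin_le_nhds
  filter_upwards [hcont (hs.mem_nhds hx), self_mem_nhdsWithin] with t hts ht0
  have ht0 : 0 < t := ht0
  have := antitone_of_concaveOn_of_hasFDerivAt hf hx hts (h _ hx) (h _ hts)
  rw [add_sub_cancel_left, map_smul, map_smul, smul_eq_mul, smul_eq_mul] at this
  have h2 := le_of_mul_le_mul_left this ht0
  rw [zero_add, zero_smul, add_zero, smul_eq_mul]
  exact mul_nonpos_of_nonneg_of_nonpos (inv_nonneg.2 ht0.le) (by linarith)

/-! ### Symmetric functions on `Γ_α` and their partial derivatives -/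

/-- The `i`-th partial derivative. -/
def d1 {n : ℕ} (f : (Fin n → ℝ) → ℝ) (κ : Fin n → ℝ) (i : Fin n) : ℝ :=
  fderiv ℝ f κ (Pi.single i 1)

/-- The second partial derivatives. -/
def d2 {n : ℕ} (f : (Fin n → ℝ) → ℝ) (κ : Fin n → ℝ) (i j : Fin n) : ℝ :=
  fderiv ℝ (fun x => fderiv ℝ f x) κ (Pi.single j 1) (Pi.single i 1)

variable {n : ℕ} {α σ : ℝ} {f : (Fin n → ℝ) → ℝ}

theorem isOpen_Gam : IsOpen (Gam n α) := by
  have : Gam n α = ⋂ i, {κ : Fin n → ℝ | α < κ i} := by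
    ext κ; simp [Gam]
  rw [this]
  exact isOpen_iInter_of_finite fun i => isOpen_lt continuous_const (continuous_apply i)

theorem comp_perm_mem_Gam {κ : Fin n → ℝ} (h : κ ∈ Gam n α) (π : Equiv.Perm (Fin n)) :
    κ ∘ π ∈ Gam n α := fun i => h (π i)

theorem hasFDerivAt_of_smooth (hf : ContDiffOn ℝ ∞ f (Gam n α)) {κ : Fin n → ℝ}
    (hκ : κ ∈ Gam n α) : HasFDerivAt f (fderiv ℝ f κ) κ :=
  ((hf.contDiffAt (isOpen_Gam.mem_nhds hκ)).differentiableAt (by simp)).hasFDerivAt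

theorem hasFDerivAt_fderiv_of_smooth (hf : ContDiffOn ℝ ∞ f (Gam n α)) {κ : Fin n → ℝ}
    (hκ : κ ∈ Gam n α) :
    HasFDerivAt (fun x => fderiv ℝ f x) (fderiv ℝ (fun x => fderiv ℝ f x) κ) κ := by
  have h1 : ContDiffAt ℝ 1 (fderiv ℝ f) κ :=
    (hf.contDiffAt (isOpen_Gam.mem_nhds hκ)).fderiv_right (m := 1) (by norm_cast)
  exact (h1.differentiableAt (by simp)).hasFDerivAt

theorem clm_apply_eq_sum {E : Type*} [NormedAddCommGroup E] [NormedSpace ℝ E]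
    (L : (Fin n → ℝ) →L[ℝ] E) (η : Fin n → ℝ) : L η = ∑ i, η i • L (Pi.single i 1) := by
  conv_lhs => rw [← Finset.univ_sum_single η, map_sum]
  refine Finset.sum_congr rfl fun i _ => ?_
  rw [← map_smul, ← Pi.single_smul, smul_eq_mul, mul_one]

theorem fderiv_apply_eq_sum (κ η : Fin n → ℝ) :
    fderiv ℝ f κ η = ∑ i, d1 f κ i * η i := by
  rw [clm_apply_eq_sum]
  simp [d1, mul_comm]

theorem hasFDerivAt_d1 (hf : ContDiffOn ℝ ∞ f (Gam n α)) {κ : Fin n → ℝ}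
    (hκ : κ ∈ Gam n α) (i : Fin n) :
    HasFDerivAt (fun x => d1 f x i)
      (∑ j, d2 f κ i j • ContinuousLinearMap.proj (R := ℝ) (φ := fun _ : Fin n => ℝ) j) κ := by
  have h := (hasFDerivAt_fderiv_of_smooth hf hκ).clm_apply
    (hasFDerivAt_const (Pi.single i (1 : ℝ) : Fin n → ℝ) κ)
  refine h.congr_fderiv ?_
  ext η
  simp only [ContinuousLinearMap.comp_zero, zero_add, ContinuousLinearMap.flip_apply,
    sum_apply, smul_apply, ContinuousLinearMap.proj_apply,
    smul_eq_mul, d2]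
  rw [clm_apply_eq_sum (fderiv ℝ (fun x => fderiv ℝ f x) κ)]
  simp [sum_apply, mul_comm]

theorem d2_comm (hf : ContDiffOn ℝ ∞ f (Gam n α)) {κ : Fin n → ℝ}
    (hκ : κ ∈ Gam n α) (i j : Fin n) : d2 f κ i j = d2 f κ j i := by
  have h := (hf.contDiffAt (isOpen_Gam.mem_nhds hκ)).isSymmSndFDerivAt (n := ∞)
    (by simpa using WithTop.coe_le_coe.2 (le_top : (2 : ℕ∞) ≤ ⊤))
  exact h.eq _ _

theorem hasFDerivAt_comp_perm (π : Equiv.Perm (Fin n)) (κ : Fin n → ℝ) :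
    HasFDerivAt (fun x : Fin n → ℝ => x ∘ π)
      (ContinuousLinearMap.pi fun i => ContinuousLinearMap.proj (R := ℝ) (φ := fun _ : Fin n => ℝ)
        (π i)) κ :=
  (ContinuousLinearMap.pi fun i => ContinuousLinearMap.proj (R := ℝ) (φ := fun _ : Fin n => ℝ)
        (π i)).hasFDerivAt

theorem single_comp_perm (π : Equiv.Perm (Fin n)) (i : Fin n) :
    (fun k => (Pi.single (π i) (1 : ℝ) : Fin n → ℝ) (π k)) = Pi.single i 1 := by
  ext k
  simp [Pi.single_apply]

theorem d1_comp_perm (hf : ContDiffOn ℝ ∞ f (Gam n α)) (hs : SymmetricOn α f) {κ : Fin n → ℝ}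
    (hκ : κ ∈ Gam n α) (π : Equiv.Perm (Fin n)) (i : Fin n) :
    d1 f (κ ∘ π) i = d1 f κ (π i) := by
  have h1 := (hasFDerivAt_of_smooth hf (comp_perm_mem_Gam hκ π)).comp κ
    (hasFDerivAt_comp_perm π κ)
  have h2 : (f ∘ fun x : Fin n → ℝ => x ∘ π) =ᶠ[𝓝 κ] f := by
    filter_upwards [isOpen_Gam.mem_nhds hκ] with x hx using hs x hx π
  have h3 := (h1.congr_of_eventuallyEq h2.symm).fderiv
  simp only [d1]
  rw [h3, ContinuousLinearMap.comp_apply, ← single_comp_perm π i]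
  rfl

theorem d2_comp_perm (hf : ContDiffOn ℝ ∞ f (Gam n α)) (hs : SymmetricOn α f) {κ : Fin n → ℝ}
    (hκ : κ ∈ Gam n α) (π : Equiv.Perm (Fin n)) (i j : Fin n) :
    d2 f (κ ∘ π) i j = d2 f κ (π i) (π j) := by
  have h1 := (hasFDerivAt_d1 hf (comp_perm_mem_Gam hκ π) i).comp κ
    (hasFDerivAt_comp_perm π κ)
  have h2 : (fun x => d1 f x (π i)) =ᶠ[𝓝 κ] ((fun x => d1 f x i) ∘ fun x : Fin n → ℝ => x ∘ π) := by
    filter_upwards [isOpen_Gam.mem_nhds hκ] with x hx using (d1_comp_perm hf hs hx π i).symm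
  have h3 := (h1.congr_of_eventuallyEq h2).unique (hasFDerivAt_d1 hf hκ (π i))
  have h4 := DFunLike.congr_fun h3 (Pi.single (π j) 1)
  simpa [Pi.single_apply] using h4

theorem comp_swap_of_eq {κ : Fin n → ℝ} {i j : Fin n} (h : κ i = κ j) :
    κ ∘ Equiv.swap i j = κ := by
  ext k
  simp only [Function.comp_apply, Equiv.swap_apply_def]
  split_ifs with h1 h2
  · rw [h1, h]
  · rw [h2, h]
  · rfl

theorem d1_eq_of_eq (hf : ContDiffOn ℝ ∞ f (Gam n α)) (hs : SymmetricOn α f) {κ : Fin n → ℝ}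
    (hκ : κ ∈ Gam n α) {i j : Fin n} (h : κ i = κ j) : d1 f κ i = d1 f κ j := by
  have := d1_comp_perm hf hs hκ (Equiv.swap i j) i
  rwa [comp_swap_of_eq h, Equiv.swap_apply_left] at this

theorem d2_diag_eq_of_eq (hf : ContDiffOn ℝ ∞ f (Gam n α)) (hs : SymmetricOn α f) {κ : Fin n → ℝ}
    (hκ : κ ∈ Gam n α) {i j : Fin n} (h : κ i = κ j) : d2 f κ i i = d2 f κ j j := by
  have := d2_comp_perm hf hs hκ (Equiv.swap i j) i i
  rwa [comp_swap_of_eq h, Equiv.swap_apply_left] at this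

theorem d2_left_eq_of_eq (hf : ContDiffOn ℝ ∞ f (Gam n α)) (hs : SymmetricOn α f) {κ : Fin n → ℝ}
    (hκ : κ ∈ Gam n α) {i i' j : Fin n} (h : κ i = κ i') (hi : j ≠ i) (hi' : j ≠ i') :
    d2 f κ i j = d2 f κ i' j := by
  have := d2_comp_perm hf hs hκ (Equiv.swap i i') i j
  rwa [comp_swap_of_eq h, Equiv.swap_apply_left, Equiv.swap_apply_of_ne_of_ne hi hi'] at this

/-- One index is exchanged at a time, by a transposition that fixes κ and the other index. If i' = j
the second index has to move first, unless the pair is simply reversed. -/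
theorem d2_offDiag_eq_of_eq (hf : ContDiffOn ℝ ∞ f (Gam n α)) (hs : SymmetricOn α f)
    {κ : Fin n → ℝ} (hκ : κ ∈ Gam n α) {i i' j j' : Fin n} (h : κ i = κ i') (h' : κ j = κ j')
    (hij : i ≠ j) (hij' : i' ≠ j') : d2 f κ i j = d2 f κ i' j' := by
  have hr : ∀ {a b b' : Fin n}, κ b = κ b' → a ≠ b → a ≠ b' → d2 f κ a b = d2 f κ a b' := by
    intro a b b' hb h1 h2
    rw [d2_comm hf hκ a b, d2_comm hf hκ a b']
    exact d2_left_eq_of_eq hf hs hκ hb h1 h2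
  by_cases h1 : i' = j
  · by_cases h2 : j' = i
    · rw [h1, h2]; exact d2_comm hf hκ _ _
    · rw [hr h' hij (Ne.symm h2)]
      exact d2_left_eq_of_eq hf hs hκ h h2 (Ne.symm hij')
  · rw [d2_left_eq_of_eq hf hs hκ h (Ne.symm hij) (Ne.symm h1)]
    exact hr h' h1 hij'

theorem d1_nonneg (hf : ContDiffOn ℝ ∞ f (Gam n α)) (hm : MonotoneOn f (Gam n α))
    {κ : Fin n → ℝ} (hκ : κ ∈ Gam n α) (i : Fin n) : 0 ≤ d1 f κ i := by
  have hline : HasDerivAt (fun t : ℝ => κ + t • (Pi.single i 1 : Fin n → ℝ)) (Pi.single i 1) 0 := by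
    simpa using ((hasDerivAt_id (0 : ℝ)).smul_const (Pi.single i 1 : Fin n → ℝ)).const_add κ
  have h0 : HasFDerivAt f (fderiv ℝ f κ) (κ + (0 : ℝ) • (Pi.single i 1 : Fin n → ℝ)) := by
    simpa using hasFDerivAt_of_smooth hf hκ
  have ht := (h0.comp_hasDerivAt 0 hline).tendsto_slope_zero_right
  refine ge_of_tendsto ht ?_
  filter_upwards [self_mem_nhdsWithin] with t ht0
  have ht0 : 0 < t := ht0
  have hle : κ ≤ κ + t • (Pi.single i 1 : Fin n → ℝ) := by
    intro k
    by_cases hk : k = i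
    · subst hk; simp [ht0.le]
    · simp [hk]
  have := hm hκ (fun k => (hκ k).trans_le (hle k)) hle
  simp only [Function.comp_apply, zero_add, zero_smul, add_zero, smul_eq_mul]
  exact mul_nonneg (inv_nonneg.2 ht0.le) (by linarith)

theorem d2_quadratic_nonpos (hf : ContDiffOn ℝ ∞ f (Gam n α)) (hc : ConcaveOn ℝ (Gam n α) f)
    {κ : Fin n → ℝ} (hκ : κ ∈ Gam n α) (η : Fin n → ℝ) :
    ∑ k, ∑ l, d2 f κ k l * η k * η l ≤ 0 := by
  refine deriv_nonpos_of_concaveOn (f' := fderiv ℝ f) (η := η) hc isOpen_Gam hκ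
    (fun y hy => hasFDerivAt_of_smooth hf hy) ?_
  have hline : HasDerivAt (fun t : ℝ => κ + t • η) η 0 := by
    simpa using ((hasDerivAt_id (0 : ℝ)).smul_const η).const_add κ
  have h1 : ∀ k, HasDerivAt (fun t : ℝ => d1 f (κ + t • η) k) (∑ l, d2 f κ k l * η l) 0 := by
    intro k
    have h0 := hasFDerivAt_d1 hf (κ := κ + (0 : ℝ) • η) (by simpa using hκ) k
    refine (h0.comp_hasDerivAt 0 hline).congr_deriv ?_
    simp
  have h2 := HasDerivAt.fun_sum (u := Finset.univ) fun k _ => (h1 k).mul_const (η k)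
  simp only [fderiv_apply_eq_sum]
  refine h2.congr_deriv ?_
  refine Finset.sum_congr rfl fun k _ => ?_
  rw [Finset.sum_mul]
  exact Finset.sum_congr rfl fun l _ => by ring

theorem fderiv_swap_sub (κ : Fin n → ℝ) (c : Fin n → ℝ) (k l : Fin n) :
    ∑ i, c i * ((κ ∘ Equiv.swap k l) i - κ i) = (c k - c l) * (κ l - κ k) := by
  by_cases hkl : k = l
  · subst hkl; simp
  rw [Finset.sum_eq_add k l hkl]
  · simp; ring
  · intro i _ hi
    rw [Function.comp_apply, Equiv.swap_apply_of_ne_of_ne hi.1 hi.2]; ring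
  · simp
  · simp

/-- Swapping κ_k and κ_l leaves f unchanged, while the tangent plane at κ bounds f from above at the
swapped point. -/
theorem d1_sub_mul_sub_nonpos (hf : ContDiffOn ℝ ∞ f (Gam n α)) (hs : SymmetricOn α f)
    (hc : ConcaveOn ℝ (Gam n α) f) {κ : Fin n → ℝ} (hκ : κ ∈ Gam n α) (k l : Fin n) :
    (d1 f κ k - d1 f κ l) * (κ k - κ l) ≤ 0 := by
  have h := le_add_of_concaveOn_of_hasFDerivAt hc hκ (comp_perm_mem_Gam hκ (Equiv.swap k l))
    (hasFDerivAt_of_smooth hf hκ)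
  rw [hs κ hκ, fderiv_apply_eq_sum] at h
  have := fderiv_swap_sub κ (d1 f κ) k l
  simp only [Pi.sub_apply] at h
  rw [this] at h
  linarith

/-! ### Inverse concavity -/

/-- The domain of the function `κ ↦ -f(σ + 1/κ)`. -/
def invDom (n : ℕ) (α σ : ℝ) : Set (Fin n → ℝ) :=
  {κ : Fin n → ℝ | (∀ i, 0 < κ i) ∧ (fun i => σ + (κ i)⁻¹) ∈ Gam n α}

theorem isOpen_invDom : IsOpen (invDom n α σ) := by
  rw [isOpen_iff_mem_nhds]
  intro κ hκ
  have h1 : ∀ᶠ x : Fin n → ℝ in 𝓝 κ, ∀ i, 0 < x i := by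
    rw [eventually_all]
    exact fun i => continuousAt_const.eventually_lt (continuous_apply i).continuousAt (hκ.1 i)
  have h2 : ContinuousAt (fun x : Fin n → ℝ => fun i => σ + (x i)⁻¹) κ := by
    refine continuousAt_pi.2 fun i => ?_
    exact continuousAt_const.add ((continuous_apply i).continuousAt.inv₀ (hκ.1 i).ne')
  filter_upwards [h1, h2 (isOpen_Gam.mem_nhds hκ.2)] with x hx hx' using ⟨hx, hx'⟩

theorem inv_mem_invDom (hσα : σ ≤ α) {κ : Fin n → ℝ} (hκ : κ ∈ Gam n α) :
    (fun i => (κ i - σ)⁻¹) ∈ invDom n α σ := by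
  refine ⟨fun i => inv_pos.2 (by linarith [hκ i]), fun i => ?_⟩
  simpa using hκ i

theorem hasFDerivAt_invFun (hf : ContDiffOn ℝ ∞ f (Gam n α)) {κ : Fin n → ℝ}
    (hκ : κ ∈ invDom n α σ) :
    HasFDerivAt (fun x : Fin n → ℝ => -f (fun i => σ + (x i)⁻¹))
      (∑ k, (d1 f (fun i => σ + (κ i)⁻¹) k * ((κ k) ^ 2)⁻¹) •
        ContinuousLinearMap.proj (R := ℝ) (φ := fun _ : Fin n => ℝ) k) κ := by
  have h1 : HasFDerivAt (fun x : Fin n → ℝ => fun i => σ + (x i)⁻¹)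
      (ContinuousLinearMap.pi fun i => (-((κ i) ^ 2)⁻¹) •
        ContinuousLinearMap.proj (R := ℝ) (φ := fun _ : Fin n => ℝ) i) κ := by
    rw [hasFDerivAt_pi]
    intro i
    exact ((hasDerivAt_inv (hκ.1 i).ne').comp_hasFDerivAt κ (hasFDerivAt_apply i κ)).const_add σ
  refine (((hasFDerivAt_of_smooth hf hκ.2).comp κ h1).neg).congr_fderiv ?_
  ext η
  rw [neg_apply, ContinuousLinearMap.comp_apply, fderiv_apply_eq_sum,
    sum_apply, ← Finset.sum_neg_distrib]
  refine Finset.sum_congr rfl fun k _ => ?_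
  simp
  ring

theorem hasDerivAt_inv_line {a : ℝ} (b : ℝ) (ha : a ≠ 0) :
    HasDerivAt (fun t : ℝ => (a + t * b)⁻¹) (-b / a ^ 2) 0 := by
  have h : HasDerivAt (fun t : ℝ => a + t * b) b 0 := by
    simpa using ((hasDerivAt_id (0 : ℝ)).mul_const b).const_add a
  simpa using h.fun_inv (by simpa using ha)

theorem hasDerivAt_inv_sq_line {a : ℝ} (b : ℝ) (ha : a ≠ 0) :
    HasDerivAt (fun t : ℝ => ((a + t * b) ^ 2)⁻¹) (-2 * b / a ^ 3) 0 := by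
  have h := (hasDerivAt_inv_line b ha).fun_pow 2
  simp only [← inv_pow]
  refine h.congr_deriv ?_
  simp
  field_simp

/-- With κ = σ + 1/y, the right side is the second derivative of -f(σ + 1/y) along ζ, with its sign
reversed, in the form the product rule produces. -/
theorem sum_add_sum_eq_neg_sum (H : Fin n → Fin n → ℝ) (p η : Fin n → ℝ) {κ y ζ : Fin n → ℝ}
    (hy : y = fun i => (κ i - σ)⁻¹) (hζ : ζ = fun i => - (y i) ^ 2 * η i)
    (hpos : ∀ i, 0 < κ i - σ) :
    ∑ k, ∑ l, H k l * η k * η l + 2 * ∑ k, p k * η k ^ 2 / (κ k - σ) =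
      -∑ k, ((∑ l, H k l * η l) * (y k ^ 2)⁻¹ + p k * (2 * η k * (κ k - σ))) * ζ k := by
  rw [Finset.mul_sum, ← Finset.sum_add_distrib, ← Finset.sum_neg_distrib]
  refine Finset.sum_congr rfl fun k _ => ?_
  have e2 : ∑ l, H k l * η k * η l = η k * ∑ l, H k l * η l := by
    rw [Finset.mul_sum]; exact Finset.sum_congr rfl fun l _ => by ring
  rw [e2]
  have := (hpos k).ne'
  simp only [hζ, hy]
  field_simp

theorem inverse_d2_quadratic_nonneg (hσα : σ ≤ α) (hf : ContDiffOn ℝ ∞ f (Gam n α))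
    (hi : InverseConcaveOn α σ f) {κ : Fin n → ℝ} (hκ : κ ∈ Gam n α) (η : Fin n → ℝ) :
    0 ≤ ∑ k, ∑ l, d2 f κ k l * η k * η l + 2 * ∑ k, d1 f κ k * η k ^ 2 / (κ k - σ) := by
  obtain ⟨y, hy⟩ : ∃ y : Fin n → ℝ, y = fun i => (κ i - σ)⁻¹ := ⟨_, rfl⟩
  have hyD : y ∈ invDom n α σ := hy ▸ inv_mem_invDom hσα hκ
  have hpos : ∀ i, 0 < κ i - σ := fun i => by linarith [hκ i]
  have hyκ : (fun i => σ + (y i)⁻¹) = κ := by ext i; simp [hy]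
  -- The velocity ζ = -y²η is chosen so that the curve σ + 1/(y + tζ) passes through κ with velocity
  -- η.
  obtain ⟨ζ, hζ⟩ : ∃ ζ : Fin n → ℝ, ζ = fun i => - (y i) ^ 2 * η i := ⟨_, rfl⟩
  have hcurve : HasDerivAt (fun t : ℝ => fun i => σ + (y i + t * ζ i)⁻¹) η 0 := by
    have hcoord : ∀ i, HasDerivAt (fun t : ℝ => σ + (y i + t * ζ i)⁻¹) (η i) 0 := by
      intro i
      have hne := (hyD.1 i).ne'
      have e : -ζ i / y i ^ 2 = η i := by simp only [hζ]; field_simp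
      have h := (hasDerivAt_inv_line (ζ i) hne).const_add σ
      rwa [e] at h
    exact hasDerivAt_pi.2 hcoord
  have h1 : ∀ k, HasDerivAt (fun t : ℝ => d1 f (fun i => σ + (y i + t * ζ i)⁻¹) k)
      (∑ l, d2 f κ k l * η l) 0 := by
    intro k
    have e0 : (fun i => σ + (y i + 0 * ζ i)⁻¹) = κ := by simpa using hyκ
    have h0 := (hasFDerivAt_d1 hf hκ k).comp_hasDerivAt_of_eq (0 : ℝ) hcurve e0.symm
    have e : (∑ j, d2 f κ k j • ContinuousLinearMap.proj (R := ℝ) (φ := fun _ : Fin n => ℝ) j) η =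
        ∑ l, d2 f κ k l * η l := by simp
    rw [e] at h0
    exact h0
  have h2 : ∀ k, HasDerivAt (fun t : ℝ => ((y k + t * ζ k) ^ 2)⁻¹)
      (2 * η k * (κ k - σ)) 0 := by
    intro k
    refine (hasDerivAt_inv_sq_line (ζ k) (hyD.1 k).ne').congr_deriv ?_
    have := (hpos k).ne'
    simp only [hζ, hy]
    field_simp
  have h3 := HasDerivAt.fun_sum (u := Finset.univ) fun k _ =>
    (((h1 k).mul (h2 k)).mul_const (ζ k))
  have h4 : HasDerivAt (fun t : ℝ => (∑ k, (d1 f (fun i => σ + ((y + t • ζ) i)⁻¹) k *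
      (((y + t • ζ) k) ^ 2)⁻¹) • ContinuousLinearMap.proj (R := ℝ) (φ := fun _ : Fin n => ℝ) k) ζ)
      _ 0 := h3.congr_of_eventuallyEq (Eventually.of_forall fun t => by simp [sum_apply])
  have hconc : ConcaveOn ℝ (invDom n α σ) (fun x : Fin n → ℝ => -f (fun i => σ + (x i)⁻¹)) := hi
  have key := deriv_nonpos_of_concaveOn hconc isOpen_invDom hyD
    (fun x hx => hasFDerivAt_invFun hf hx) h4
  simp only [zero_mul, add_zero] at key
  have e1 : (fun i => σ + (y i)⁻¹) = κ := hyκ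
  rw [e1] at key
  have := sum_add_sum_eq_neg_sum (d2 f κ) (d1 f κ) η hy hζ hpos
  rw [this]
  linarith

/-- The swapping argument again, now for y ↦ -f(σ + 1/y), whose partial derivatives are p_k (κ_k -
σ)². -/
theorem inverse_d1_sub_mul_sub_nonneg (hσα : σ ≤ α) (hf : ContDiffOn ℝ ∞ f (Gam n α))
    (hs : SymmetricOn α f) (hi : InverseConcaveOn α σ f) {κ : Fin n → ℝ} (hκ : κ ∈ Gam n α)
    (k l : Fin n) :
    0 ≤ (κ k - κ l) * (d1 f κ k * (κ k - σ) ^ 2 - d1 f κ l * (κ l - σ) ^ 2) := by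
  set y : Fin n → ℝ := fun i => (κ i - σ)⁻¹ with hy
  have hyD : y ∈ invDom n α σ := inv_mem_invDom hσα hκ
  have hpos : ∀ i, 0 < κ i - σ := fun i => by linarith [hκ i]
  have hyκ : (fun i => σ + (y i)⁻¹) = κ := by ext i; simp [hy]
  have hyD' : y ∘ Equiv.swap k l ∈ invDom n α σ :=
    inv_mem_invDom hσα (comp_perm_mem_Gam hκ (Equiv.swap k l))
  have h := le_add_of_concaveOn_of_hasFDerivAt hi hyD hyD' (hasFDerivAt_invFun hf hyD)
  have e2 : (fun i => σ + ((y ∘ Equiv.swap k l) i)⁻¹) = κ ∘ Equiv.swap k l := by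
    ext i; simp [hy]
  simp only [e2, hyκ, hs κ hκ] at h
  have := fderiv_swap_sub y (fun k => d1 f κ k * (y k ^ 2)⁻¹) k l
  simp only [sum_apply, smul_apply,
    ContinuousLinearMap.proj_apply, smul_eq_mul, Pi.sub_apply] at h
  rw [this] at h
  have h' : 0 ≤ (d1 f κ k * (y k ^ 2)⁻¹ - d1 f κ l * (y l ^ 2)⁻¹) * (y l - y k) := by linarith
  have e3 : (κ k - κ l) * (d1 f κ k * (κ k - σ) ^ 2 - d1 f κ l * (κ l - σ) ^ 2) =
      (κ k - σ) * (κ l - σ) *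
        ((d1 f κ k * (y k ^ 2)⁻¹ - d1 f κ l * (y l ^ 2)⁻¹) * (y l - y k)) := by
    have h1 := (hpos k).ne'
    have h2 := (hpos l).ne'
    simp only [hy]
    field_simp
    ring
  rw [e3]
  exact mul_nonneg (mul_nonneg (hpos k).le (hpos l).le) h'

/-! ### Vanishing partial derivatives -/

/-- Along the coordinates in S the tangent plane is horizontal, both for f and for -f(σ + 1/y).
Concavity of the first gives f y ≤ f x, concavity of the second the reverse. -/
theorem eq_of_d1_eq_zero_on (hσα : σ ≤ α) (hf : ContDiffOn ℝ ∞ f (Gam n α))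
    (hc : ConcaveOn ℝ (Gam n α) f) (hi : InverseConcaveOn α σ f) {S : Finset (Fin n)}
    {x y : Fin n → ℝ} (hx : x ∈ Gam n α) (hy : y ∈ Gam n α) (h0 : ∀ i ∈ S, d1 f x i = 0)
    (hxy : ∀ i ∉ S, y i = x i) : f y = f x := by
  apply le_antisymm
  · have h := le_add_of_concaveOn_of_hasFDerivAt hc hx hy (hasFDerivAt_of_smooth hf hx)
    rw [fderiv_apply_eq_sum, Finset.sum_eq_zero, add_zero] at h
    · exact h
    · intro i _
      by_cases hiS : i ∈ S
      · rw [h0 i hiS, zero_mul]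
      · rw [Pi.sub_apply, hxy i hiS, sub_self, mul_zero]
  · have hx' := inv_mem_invDom hσα hx
    have hy' := inv_mem_invDom hσα hy
    have h := le_add_of_concaveOn_of_hasFDerivAt hi hx' hy' (hasFDerivAt_invFun hf hx')
    simp only [inv_inv, add_sub_cancel, sum_apply, smul_apply, ContinuousLinearMap.proj_apply,
      smul_eq_mul, Pi.sub_apply] at h
    rw [Finset.sum_eq_zero, add_zero] at h
    · exact neg_le_neg_iff.1 h
    · intro i _
      by_cases hiS : i ∈ S
      · rw [h0 i hiS, zero_mul, zero_mul]
      · rw [hxy i hiS, sub_self, mul_zero]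

theorem d1_eq_zero_on (hσα : σ ≤ α) (hf : ContDiffOn ℝ ∞ f (Gam n α))
    (hc : ConcaveOn ℝ (Gam n α) f) (hi : InverseConcaveOn α σ f) {S : Finset (Fin n)}
    {x y : Fin n → ℝ} (hx : x ∈ Gam n α) (hy : y ∈ Gam n α) (h0 : ∀ i ∈ S, d1 f x i = 0)
    (hxy : ∀ i ∉ S, y i = x i) : ∀ i ∈ S, d1 f y i = 0 := by
  intro i hiS
  have hline : HasDerivAt (fun t : ℝ => y + t • (Pi.single i 1 : Fin n → ℝ)) (Pi.single i 1) 0 := by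
    simpa using ((hasDerivAt_id (0 : ℝ)).smul_const (Pi.single i 1 : Fin n → ℝ)).const_add y
  have h1 := (hasFDerivAt_of_smooth hf hy).comp_hasDerivAt_of_eq (0 : ℝ) hline (by simp)
  have hcont : Tendsto (fun t : ℝ => y + t • (Pi.single i 1 : Fin n → ℝ)) (𝓝 0) (𝓝 y) := by
    simpa using hline.continuousAt.tendsto
  have h2 : (f ∘ fun t : ℝ => y + t • (Pi.single i 1 : Fin n → ℝ)) =ᶠ[𝓝 0] fun _ => f x := by
    filter_upwards [hcont (isOpen_Gam.mem_nhds hy)] with t ht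
    refine eq_of_d1_eq_zero_on hσα hf hc hi hx ht h0 fun j hj => ?_
    have : j ≠ i := fun h => hj (h ▸ hiS)
    simp [this, hxy j hj]
  exact (h1.congr_of_eventuallyEq h2.symm).unique (hasDerivAt_const _ _)

/-- A vanishing partial derivative spreads. The coordinates in which f is already flat can be moved
freely, so they can be made equal to another coordinate j; by symmetry the j-th partial derivative
then vanishes too. Once all coordinates are reached, f is constant. -/
theorem eq_of_d1_eq_zero (hσα : σ ≤ α) (hf : ContDiffOn ℝ ∞ f (Gam n α))
    (hs : SymmetricOn α f) (hc : ConcaveOn ℝ (Gam n α) f) (hi : InverseConcaveOn α σ f)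
    {κ : Fin n → ℝ} (hκ : κ ∈ Gam n α) {k : Fin n} (hk : d1 f κ k = 0) {y : Fin n → ℝ}
    (hy : y ∈ Gam n α) : f y = f κ := by
  have key : ∀ S : Finset (Fin n), ∃ x ∈ Gam n α, f x = f κ ∧ ∀ i ∈ insert k S, d1 f x i = 0 := by
    intro S
    induction S using Finset.induction_on with
    | empty => exact ⟨κ, hκ, rfl, by simpa using hk⟩
    | insert j S hjS ih =>
      obtain ⟨x, hx, hfx, h0⟩ := ih
      by_cases hj : j ∈ insert k S
      · exact ⟨x, hx, hfx, by rwa [Finset.insert_comm, Finset.insert_eq_of_mem hj]⟩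
      -- All flat coordinates are given the value x_j, so that y_k = y_j.
      · set y : Fin n → ℝ := fun i => if i ∈ insert k S then x j else x i with hydef
        have hy : y ∈ Gam n α := fun i => by
          simp only [hydef]
          split_ifs
          · exact hx j
          · exact hx i
        have hxy : ∀ i ∉ insert k S, y i = x i := fun i hi => by simp only [hydef, if_neg hi]
        have h0' := d1_eq_zero_on hσα hf hc hi hx hy h0 hxy
        refine ⟨y, hy, (eq_of_d1_eq_zero_on hσα hf hc hi hx hy h0 hxy).trans hfx, ?_⟩
        rw [Finset.insert_comm]
        intro i hi
        rcases Finset.mem_insert.1 hi with rfl | hi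
        · have hkS : k ∈ insert k S := Finset.mem_insert_self _ _
          rw [← h0' k hkS]
          refine d1_eq_of_eq hf hs hy ?_
          simp only [hydef, if_pos hkS, if_neg hj]
        · exact h0' i hi
  obtain ⟨x, hx, hfx, h0⟩ := key Finset.univ
  rw [← hfx]
  exact eq_of_d1_eq_zero_on hσα hf hc hi hx hy h0 (by simp)

/-! ### The inequality in an eigenbasis -/

section Core

variable {ι : Type*} [Fintype ι] [DecidableEq ι]

/-- The quadratic form `∑ H_kl B_kk B_ll + ∑_{k ≠ l} c_kl B_kl²`. -/
def specQuad (H c B : ι → ι → ℝ) : ℝ :=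
  ∑ k, ∑ l, H k l * B k k * B l l + ∑ k, ∑ l, if k = l then 0 else c k l * B k l ^ 2

/-- The expression under the supremum, in an eigenbasis. -/
def specGamma (o : ι) (ε : ℝ) (x p : ι → ℝ) (T : ι → ι → ι → ℝ) (g : ι → ι → ℝ) : ℝ :=
  ∑ k, p k * ∑ a, (2 * g a k * (T k a o - ε * (∑ b, T k b b) * if a = o then 1 else 0)
    - g a k ^ 2 * (x a - x o))

theorem sum_sum_eq_erase (o : ι) (M : ι → ι → ℝ) :
    ∑ k, ∑ l, M k l = M o o + ∑ l ∈ Finset.univ.erase o, (M o l + M l o) +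
      ∑ k ∈ Finset.univ.erase o, ∑ l ∈ Finset.univ.erase o, M k l := by
  have h : ∀ φ : ι → ℝ, ∑ k, φ k = φ o + ∑ k ∈ Finset.univ.erase o, φ k := fun φ =>
    (Finset.add_sum_erase _ _ (Finset.mem_univ o)).symm
  rw [h, h, Finset.sum_add_distrib, Finset.sum_congr rfl fun k _ => h (M k),
    Finset.sum_add_distrib]
  ring

/-- All summands are nonpositive under concavity, so everything but the two equal entries oa and ao
may be dropped. -/
theorem specQuad_le (o a : ι) (hoa : a ≠ o) {H c : ι → ι → ℝ} (B : ι → ι → ℝ)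
    (hB : B a o = B o a) (hcsymm : ∀ k l, c k l = c l k)
    (hH : ∀ η : ι → ℝ, ∑ k, ∑ l, H k l * η k * η l ≤ 0)
    (hc : ∀ k l, k ≠ l → c k l ≤ 0) : specQuad H c B ≤ 2 * c o a * B o a ^ 2 := by
  have h1 := hH fun k => B k k
  set M : ι → ι → ℝ := fun k l => if k = l then 0 else c k l * B k l ^ 2 with hM
  have hM0 : ∀ k l, M k l ≤ 0 := fun k l => by
    simp only [hM]
    split_ifs with h
    · exact le_rfl
    · exact mul_nonpos_of_nonpos_of_nonneg (hc k l h) (sq_nonneg _)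
  have h2 := sum_sum_eq_erase o M
  have h3 : ∑ l ∈ Finset.univ.erase o, (M o l + M l o) ≤ M o a + M a o := by
    have ha : a ∈ Finset.univ.erase o := by simp [hoa]
    rw [← Finset.add_sum_erase _ _ ha]
    have : ∑ l ∈ (Finset.univ.erase o).erase a, (M o l + M l o) ≤ 0 :=
      Finset.sum_nonpos fun l _ => add_nonpos (hM0 _ _) (hM0 _ _)
    linarith
  have h4 : ∑ k ∈ Finset.univ.erase o, ∑ l ∈ Finset.univ.erase o, M k l ≤ 0 :=
    Finset.sum_nonpos fun k _ => Finset.sum_nonpos fun l _ => hM0 _ _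
  have h5 : M o a + M a o = 2 * c o a * B o a ^ 2 := by
    simp only [hM, if_neg hoa, if_neg (Ne.symm hoa), hB, hcsymm a o]; ring
  have h6 := hM0 o o
  have h7 : specQuad H c B = ∑ k, ∑ l, H k l * B k k * B l l + ∑ k, ∑ l, M k l := rfl
  linarith

/-- The diagonal coefficient -2p_k/x_k is the case k = l of the off-diagonal lower bound -(p_k/x_l +
p_l/x_k), so Q is bounded below by a sum of squares of single entries. -/
theorem le_specQuad {H c : ι → ι → ℝ} {x p : ι → ℝ} (B : ι → ι → ℝ)
    (hH : ∀ η : ι → ℝ, 0 ≤ ∑ k, ∑ l, H k l * η k * η l + 2 * ∑ k, p k * η k ^ 2 / x k) :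
    ∑ k, ∑ l, (if k = l then -2 * p k / x k else c k l) * B k l ^ 2 ≤ specQuad H c B := by
  have h1 := hH fun k => B k k
  have h2 : ∑ k, ∑ l, (if k = l then -2 * p k / x k else c k l) * B k l ^ 2 =
      -(2 * ∑ k, p k * B k k ^ 2 / x k) +
        ∑ k, ∑ l, if k = l then 0 else c k l * B k l ^ 2 := by
    rw [Finset.mul_sum, ← Finset.sum_neg_distrib, ← Finset.sum_add_distrib]
    refine Finset.sum_congr rfl fun k _ => ?_
    have : -(2 * (p k * B k k ^ 2 / x k)) =
        ∑ l, if k = l then -(2 * (p k * B k k ^ 2 / x k)) else 0 := by simp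
    rw [this, ← Finset.sum_add_distrib]
    refine Finset.sum_congr rfl fun l _ => ?_
    by_cases h : k = l
    · subst h; simp; ring
    · simp [h]
  rw [h2]
  simp only [specQuad]
  linarith

/-- Removing the index o gives (1-ε) b_o = ε ∑' b_a and (1-ε) x_o = ε ∑' x_a; now apply (∑' b_a)² ≤
(∑' x_a)(∑' b_a²/x_a). -/
theorem weighted_cauchy_trace (o : ι) {x b : ι → ℝ} {ε : ℝ} (hx : ∀ k, 0 < x k)
    (hε : ε * ∑ k, x k = x o) (hε0 : 0 ≤ ε) (hε1 : ε ≤ 1) (hb : b o = ε * ∑ k, b k) :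
    (1 - ε) * b o ^ 2 / x o ≤ ε * ∑ a ∈ Finset.univ.erase o, b a ^ 2 / x a := by
  rw [← Finset.add_sum_erase _ _ (Finset.mem_univ o)] at hε hb
  set s := Finset.univ.erase o
  have hW : 0 ≤ ∑ a ∈ s, b a ^ 2 / x a :=
    Finset.sum_nonneg fun a _ => div_nonneg (sq_nonneg _) (hx a).le
  have hcs : (∑ a ∈ s, b a) ^ 2 ≤ (∑ a ∈ s, x a) * ∑ a ∈ s, b a ^ 2 / x a :=
    Finset.sum_sq_le_sum_mul_sum_of_sq_le_mul s (fun a _ => (hx a).le)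
      (fun a _ => div_nonneg (sq_nonneg _) (hx a).le)
      fun a _ => le_of_eq (by have := (hx a).ne'; field_simp)
  -- The factor 1 - ε can be cancelled only if it is nonzero; for ε = 1 the left side is 0.
  rcases hε1.lt_or_eq with hlt | rfl
  · rw [div_le_iff₀ (hx o)]
    have h1 : 0 < 1 - ε := by linarith
    refine le_of_mul_le_mul_left ?_ h1
    have h2 : (1 - ε) * b o = ε * ∑ a ∈ s, b a := by linarith
    have h3 : (1 - ε) * x o = ε * ∑ a ∈ s, x a := by linarith
    calc (1 - ε) * ((1 - ε) * b o ^ 2) = ((1 - ε) * b o) ^ 2 := by ring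
      _ = ε ^ 2 * (∑ a ∈ s, b a) ^ 2 := by rw [h2]; ring
      _ ≤ ε ^ 2 * ((∑ a ∈ s, x a) * ∑ a ∈ s, b a ^ 2 / x a) :=
        mul_le_mul_of_nonneg_left hcs (sq_nonneg _)
      _ = ε * (ε * ∑ a ∈ s, x a) * ∑ a ∈ s, b a ^ 2 / x a := by ring
      _ = ε * ((1 - ε) * x o) * ∑ a ∈ s, b a ^ 2 / x a := by rw [h3]
      _ = (1 - ε) * (ε * (∑ a ∈ s, b a ^ 2 / x a) * x o) := by ring
  · simpa using hW

/-- This g completes the square. Since 0⁻¹ = 0, it vanishes where x_a = x_o, in particular at a = o,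
where the term with ε would enter. -/
theorem specGamma_regular (o : ι) (ε : ℝ) (x p : ι → ℝ) (T : ι → ι → ι → ℝ) :
    specGamma o ε x p T (fun a k => T k a o * (x a - x o)⁻¹) =
      ∑ k, ∑ a, p k * (x a - x o)⁻¹ * T k a o ^ 2 := by
  unfold specGamma
  refine Finset.sum_congr rfl fun k _ => ?_
  rw [Finset.mul_sum]
  refine Finset.sum_congr rfl fun a _ => ?_
  by_cases ha : x a = x o
  · have : x a - x o = 0 := sub_eq_zero.2 ha
    simp [this]
  · have hao : a ≠ o := fun h => ha (by rw [h])
    have : x a - x o ≠ 0 := sub_ne_zero.2 ha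
    rw [if_neg hao]
    field_simp
    ring

/-- On a g supported at the single entry (a, k) the quadratic term vanishes, because x_a = x_o; what
remains is linear with nonzero slope 2 p_k w. -/
theorem specGamma_singular (o : ι) {ε : ℝ} {x p : ι → ℝ} {T : ι → ι → ι → ℝ} {a k : ι}
    (hp : p k ≠ 0) (ha : x a = x o)
    (h : T k a o - ε * (∑ b, T k b b) * (if a = o then 1 else 0) ≠ 0) (R : ℝ) :
    ∃ g, specGamma o ε x p T g = R := by
  set w := T k a o - ε * (∑ b, T k b b) * (if a = o then 1 else 0) with hw
  refine ⟨fun a' k' => if a' = a ∧ k' = k then R / (2 * p k * w) else 0, ?_⟩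
  unfold specGamma
  rw [Finset.sum_eq_single k, Finset.sum_eq_single a]
  · simp only [and_self, if_true, ha, sub_self, mul_zero, sub_zero]
    rw [← hw]
    field_simp
  · intro b _ hb; simp [hb]
  · simp
  · intro l _ hl; simp [hl]
  · simp

/-- The inequality in an eigenbasis whose vector with index `o` belongs to the smallest eigenvalue.
If the linear part of `specGamma` does not vanish on the kernel of its quadratic part, then
`specGamma` is unbounded above; in particular it is when `T k o o = ε ∑ b, T k b b` fails. -/
theorem exists_specGamma_nonneg (o : ι) {x p : ι → ℝ} {H c : ι → ι → ℝ} {T : ι → ι → ι → ℝ} {ε : ℝ}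
    (hT : ∀ i j k, T i j k = T j i k ∧ T i j k = T i k j)
    (hx : ∀ k, 0 < x k) (ho : ∀ k, x o ≤ x k) (hp : ∀ k, 0 < p k)
    (hε : ε * ∑ k, x k = x o) (hε0 : 0 ≤ ε) (hε1 : ε ≤ 1)
    (hcsymm : ∀ k l, c k l = c l k) (hcle : ∀ k l, k ≠ l → c k l ≤ 0)
    (hcge : ∀ k l, k ≠ l → -(p k / x l + p l / x k) ≤ c k l)
    (hceq : ∀ k l, c k l * (x k - x l) = p k - p l ∨ x k = x l)
    (hHle : ∀ η : ι → ℝ, ∑ k, ∑ l, H k l * η k * η l ≤ 0)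
    (hHge : ∀ η : ι → ℝ, 0 ≤ ∑ k, ∑ l, H k l * η k * η l + 2 * ∑ k, p k * η k ^ 2 / x k) :
    ∃ g, 0 ≤ specQuad H c (T o) - ε * ∑ a, specQuad H c (T a) + 2 * specGamma o ε x p T g := by
  by_cases hreg : ∀ a k, x a = x o → T k a o - ε * (∑ b, T k b b) * (if a = o then 1 else 0) = 0
  swap
  · push Not at hreg
    obtain ⟨a, k, ha, hne⟩ := hreg
    obtain ⟨g, hg⟩ := specGamma_singular o (hp k).ne' ha hne
      (-(specQuad H c (T o) - ε * ∑ a, specQuad H c (T a)) / 2)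
    exact ⟨g, by rw [hg]; linarith⟩
  · refine ⟨fun a k => T k a o * (x a - x o)⁻¹, ?_⟩
    rw [specGamma_regular]
    set s := Finset.univ.erase o with hs
    set E : ι → ℝ := fun a => (x a - x o)⁻¹ with hE
    set b : ι → ι → ℝ := T o with hb
    have hbT : ∀ k a, T k a o = b k a := fun k a => by
      rw [hb, (hT k a o).2, (hT k o a).1]
    have hbsymm : ∀ k a, b k a = b a k := fun k a => (hT o k a).2
    have hbz : ∀ k, ∀ a ∈ s, x a = x o → b k a = 0 := by
      intro k a ha hxa
      have := hreg a k hxa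
      rw [if_neg (Finset.ne_of_mem_erase ha), mul_zero, sub_zero, hbT] at this
      exact this
    have hEx : ∀ a ∈ s, ∀ k, E a * b k a ^ 2 ≥ b k a ^ 2 / x a := by
      intro a ha k
      by_cases hxa : x a = x o
      · simp [hbz k a ha hxa]
      · have h1 : 0 < x a - x o := sub_pos.2 (lt_of_le_of_ne (ho a) (Ne.symm hxa))
        have h2 : (x a)⁻¹ ≤ E a := inv_anti₀ h1 (by linarith [hx o])
        rw [div_eq_mul_inv, mul_comm (b k a ^ 2)]
        exact mul_le_mul_of_nonneg_right h2 (sq_nonneg _)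
    -- Multiplying by b_ka² makes the identity hold for equal eigenvalues as well, where c_oa is not
    -- a difference quotient but b_ka = 0.
    have hcE : ∀ a ∈ s, ∀ k, c o a * b k a ^ 2 = -(p o - p a) * E a * b k a ^ 2 := by
      intro a ha k
      by_cases hxa : x a = x o
      · simp [hbz k a ha hxa]
      · rcases hceq o a with h | h
        · have : x a - x o ≠ 0 := sub_ne_zero.2 hxa
          rw [← h]
          simp only [hE]
          field_simp
          ring
        · exact absurd h.symm hxa
    have hcauchy := weighted_cauchy_trace o (b := fun k => b k k) hx hε hε0 hε1 (by
      have := hreg o o rfl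
      rw [if_pos rfl, mul_one, sub_eq_zero] at this
      exact this)
    have hQo := le_specQuad (c := c) b hHge
    rw [sum_sum_eq_erase o, if_pos rfl, Finset.sum_congr rfl fun l (hl : l ∈ s) => by
      rw [if_neg (Finset.ne_of_mem_erase hl), if_neg (Finset.ne_of_mem_erase hl).symm]] at hQo
    have hQa : ∑ a, specQuad H c (T a) ≤
        specQuad H c b + ∑ a ∈ s, 2 * (c o a * b a a ^ 2) := by
      rw [← Finset.add_sum_erase _ _ (Finset.mem_univ o)]
      refine add_le_add le_rfl (Finset.sum_le_sum fun a ha => ?_)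
      have := specQuad_le o a (Finset.ne_of_mem_erase ha) (T a) (hT a a o).2 hcsymm hHle hcle
      rw [(hT a o a).1, mul_assoc] at this
      exact this
    have hEo : E o = 0 := by simp [hE]
    have hG : ∑ k, ∑ a, p k * E a * T k a o ^ 2 =
        ∑ l ∈ s, p o * E l * b o l ^ 2 + ∑ k ∈ s, ∑ l ∈ s, p k * E l * b k l ^ 2 := by
      rw [sum_sum_eq_erase o]
      simp only [hEo, mul_zero, zero_mul, add_zero, zero_add, hbT]
      rfl
    have hGsymm : ∑ k ∈ s, ∑ l ∈ s, p k * E l * b k l ^ 2 =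
        ∑ k ∈ s, ∑ l ∈ s, p l * E k * b k l ^ 2 := by
      rw [Finset.sum_comm]
      exact Finset.sum_congr rfl fun k _ => Finset.sum_congr rfl fun l _ => by rw [hbsymm]
    -- the terms with one index equal to `o`
    have hmix : 0 ≤ ∑ l ∈ s, ((1 - ε) * (c o l * b o l ^ 2 + c l o * b l o ^ 2) +
        2 * (p o * E l * b o l ^ 2)) := by
      refine Finset.sum_nonneg fun l hl => ?_
      rw [hcsymm l o, hbsymm l o, hcE l hl o]
      have h1 := hEx l hl o
      have h2 : 0 ≤ E l * b o l ^ 2 := (div_nonneg (sq_nonneg _) (hx l).le).trans h1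
      -- With c_ol replaced, the summand is exactly twice this product.
      have h3 : 0 ≤ ((1 - ε) * p l + ε * p o) * (E l * b o l ^ 2) :=
        mul_nonneg (add_nonneg (mul_nonneg (by linarith) (hp l).le)
          (mul_nonneg hε0 (hp o).le)) h2
      nlinarith
    -- the terms with no index equal to `o`
    have hrest : 0 ≤ ∑ k ∈ s, ∑ l ∈ s,
        ((1 - ε) * ((if k = l then -2 * p k / x k else c k l) * b k l ^ 2) +
          (p k * E l * b k l ^ 2 + p l * E k * b k l ^ 2) +
          if k = l then -2 * ε * (c o k * b k k ^ 2) - 2 * ε * p o * (b k k ^ 2 / x k) else 0) := by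
      refine Finset.sum_nonneg fun k hk => Finset.sum_nonneg fun l hl => ?_
      have h1 := mul_le_mul_of_nonneg_left (hEx l hl k) (hp k).le
      have h2 := mul_le_mul_of_nonneg_left (hEx k hk l) (hp l).le
      rw [hbsymm l k] at h2
      by_cases hkl : k = l
      · subst hkl
        rw [if_pos rfl, if_pos rfl, hcE k hk k]
        -- The diagonal summand collapses to 2((1-ε) p_k + ε p_o)(E_k - 1/x_k) b_kk².
        have h3 := mul_le_mul_of_nonneg_left (hEx k hk k)
          (add_nonneg (mul_nonneg (sub_nonneg.2 hε1) (hp k).le) (mul_nonneg hε0 (hp o).le))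
        have h4 : -2 * p k / x k * b k k ^ 2 = -2 * p k * (b k k ^ 2 / x k) := by ring
        rw [h4]
        nlinarith
      · rw [if_neg hkl, if_neg hkl, add_zero]
        have h3 := mul_le_mul_of_nonneg_right (hcge k l hkl) (sq_nonneg (b k l))
        have h4 := mul_le_mul_of_nonneg_left h3 (sub_nonneg.2 hε1)
        have h5 : 0 ≤ ε * ((p k / x l + p l / x k) * b k l ^ 2) :=
          mul_nonneg hε0 (mul_nonneg (add_nonneg (div_nonneg (hp k).le (hx l).le)
            (div_nonneg (hp l).le (hx k).le)) (sq_nonneg _))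
        have h6 : (p k / x l + p l / x k) * b k l ^ 2 =
          p k * (b k l ^ 2 / x l) + p l * (b k l ^ 2 / x k) := by ring
        nlinarith
    rw [Finset.sum_add_distrib, ← Finset.mul_sum, ← Finset.mul_sum] at hmix
    have hdiag : ∀ φ : ι → ℝ, ∑ k ∈ s, ∑ l ∈ s, (if k = l then φ k else 0) = ∑ k ∈ s, φ k := by
      intro φ
      refine Finset.sum_congr rfl fun k hk => ?_
      rw [Finset.sum_ite_eq, if_pos hk]
    simp only [Finset.sum_add_distrib, hdiag, Finset.sum_sub_distrib, ← Finset.mul_sum] at hrest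
    rw [hG]
    simp only [← Finset.mul_sum] at hQa
    have h1 := mul_le_mul_of_nonneg_left hQa hε0
    have h2 := mul_le_mul_of_nonneg_left hQo (sub_nonneg.2 hε1)
    have h3 := mul_le_mul_of_nonneg_left hcauchy (mul_nonneg zero_le_two (hp o).le)
    have h4 : 2 * p o * ((1 - ε) * b o o ^ 2 / x o) =
      -((1 - ε) * (-2 * p o / x o * b o o ^ 2)) := by ring
    rw [h4] at h3
    linarith

end Core

/-! ### Spectral decompositions -/

/-- `X = U diag(l) Uᵀ` with `U` orthogonal. -/
structure IsSpectral (X U : Matrix (Fin n) (Fin n) ℝ) (l : Fin n → ℝ) : Prop where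
  orth : Uᵀ * U = 1
  eq : X = U * Matrix.diagonal l * Uᵀ

namespace IsSpectral

variable {X U V : Matrix (Fin n) (Fin n) ℝ} {l m : Fin n → ℝ}

theorem orth' (h : IsSpectral X U l) : U * Uᵀ = 1 := mul_eq_one_comm.1 h.orth

theorem transpose_mul (h : IsSpectral X U l) : Uᵀ * X = Matrix.diagonal l * Uᵀ := by
  rw [h.eq, Matrix.mul_assoc, ← Matrix.mul_assoc, h.orth, Matrix.one_mul]

theorem mul_right (h : IsSpectral X U l) : X * U = U * Matrix.diagonal l := by
  rw [h.eq, Matrix.mul_assoc, h.orth, Matrix.mul_one]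

theorem comp_perm (h : IsSpectral X U l) (π : Equiv.Perm (Fin n)) :
    IsSpectral X (U.submatrix id π) (l ∘ π) := by
  have hd : Matrix.diagonal (l ∘ π) = (Matrix.diagonal l).submatrix π π :=
    (Matrix.submatrix_diagonal_equiv l π).symm
  constructor
  · rw [Matrix.transpose_submatrix, Matrix.submatrix_mul _ _ π id π Function.bijective_id |>.symm,
      h.orth, Matrix.submatrix_one_equiv]
  · rw [Matrix.transpose_submatrix, hd,
      ← Matrix.submatrix_mul _ _ id π π π.bijective,
      ← Matrix.submatrix_mul _ _ id π id π.bijective, ← h.eq, Matrix.submatrix_id_id]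

theorem aeval (h : IsSpectral X U l) (q : ℝ[X]) :
    IsSpectral (Polynomial.aeval X q) U (fun i => q.eval (l i)) := by
  refine ⟨h.orth, ?_⟩
  induction q using Polynomial.induction_on' with
  | add p q hp hq =>
    rw [map_add, hp, hq, ← Matrix.add_mul, ← Matrix.mul_add, Matrix.diagonal_add]
    simp
  | monomial k a =>
    have hpow : ∀ k : ℕ, X ^ k = U * Matrix.diagonal (fun i => l i ^ k) * Uᵀ := by
      intro k
      induction k with
      | zero => simp [h.orth']
      | succ k ih =>
        rw [pow_succ, ih, Matrix.mul_assoc, h.transpose_mul, ← Matrix.mul_assoc,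
          Matrix.mul_assoc U, Matrix.diagonal_mul_diagonal]
        simp [pow_succ]
    rw [Polynomial.aeval_monomial, hpow k, Algebra.algebraMap_eq_smul_one, smul_one_mul]
    have : (fun i => (Polynomial.monomial k a).eval (l i)) = a • fun i => l i ^ k := by
      ext i; simp
    rw [this, Matrix.diagonal_smul, Matrix.mul_smul, Matrix.smul_mul]

theorem trace_eq (h : IsSpectral X U l) : X.trace = ∑ i, l i := by
  rw [h.eq, Matrix.trace_mul_comm, ← Matrix.mul_assoc, h.orth, Matrix.one_mul,
    Matrix.trace_diagonal]

theorem trace_mul_eq (h : IsSpectral X U l) (B : Matrix (Fin n) (Fin n) ℝ) :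
    (X * B).trace = ∑ i, l i * (Uᵀ * B * U) i i := by
  rw [h.eq, Matrix.mul_assoc, Matrix.mul_assoc, Matrix.trace_mul_comm, Matrix.mul_assoc]
  simp [Matrix.trace, Matrix.diagonal_mul]

theorem abs_entry_le_one (h : IsSpectral X U l) (i j : Fin n) : |U i j| ≤ 1 := by
  have h1 := congrFun (congrFun h.orth j) j
  rw [Matrix.mul_apply, Matrix.one_apply_eq] at h1
  simp only [Matrix.transpose_apply] at h1
  have h2 : U i j * U i j ≤ ∑ k, U k j * U k j :=
    Finset.single_le_sum (f := fun k => U k j * U k j) (fun k _ => mul_self_nonneg _)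
      (Finset.mem_univ i)
  rw [← sq_le_one_iff_abs_le_one]
  nlinarith

/-- The bound does not depend on U, so eigenbases that vary discontinuously with X are harmless. -/
theorem abs_conj_diag_le (h : IsSpectral X U l) (B : Matrix (Fin n) (Fin n) ℝ) (i : Fin n) :
    |(Uᵀ * B * U) i i| ≤ (n : ℝ) * (n : ℝ) * ‖B‖ := by
  have h1 : (Uᵀ * B * U) i i = ∑ k, ∑ j, U j i * B j k * U k i := by
    simp [Matrix.mul_apply, Finset.sum_mul]
  rw [h1]
  refine (Finset.abs_sum_le_sum_abs _ _).trans ?_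
  have h2 : ∀ k ∈ Finset.univ, |∑ j, U j i * B j k * U k i| ≤ (n : ℝ) * ‖B‖ := by
    intro k _
    refine (Finset.abs_sum_le_sum_abs _ _).trans ?_
    have h3 : ∀ j ∈ Finset.univ, |U j i * B j k * U k i| ≤ ‖B‖ := by
      intro j _
      rw [abs_mul, abs_mul]
      have hB : |B j k| ≤ ‖B‖ := Matrix.norm_entry_le_entrywise_sup_norm B
      calc |U j i| * |B j k| * |U k i| ≤ 1 * ‖B‖ * 1 := by
            gcongr
            · exact h.abs_entry_le_one j i
            · exact h.abs_entry_le_one k i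
        _ = ‖B‖ := by ring
    refine (Finset.sum_le_sum h3).trans ?_
    simp
  refine (Finset.sum_le_sum h2).trans ?_
  simp [mul_assoc]

end IsSpectral

theorem exists_isSpectral (A : SymMat n) :
    ∃ U, IsSpectral (A : Matrix (Fin n) (Fin n) ℝ) U (eig A) := by
  have hA := SymMat.isHermitian A
  refine ⟨hA.eigenvectorUnitary, ?_, ?_⟩
  · have := Unitary.coe_star_mul_self hA.eigenvectorUnitary
    rwa [Matrix.star_eq_conjTranspose, Matrix.conjTranspose_eq_transpose_of_trivial] at this
  · have := hA.spectral_theorem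
    rw [Unitary.conjStarAlgAut_apply, Matrix.star_eq_conjTranspose,
      Matrix.conjTranspose_eq_transpose_of_trivial] at this
    exact this

/-! ### Perturbation of eigenvalues -/

theorem sum_sq_eq_trace (M : Matrix (Fin n) (Fin n) ℝ) :
    ∑ i, ∑ j, M i j ^ 2 = (Mᵀ * M).trace := by
  rw [Finset.sum_comm]
  simp [Matrix.trace, Matrix.mul_apply, sq]

theorem sum_sq_conj {U V : Matrix (Fin n) (Fin n) ℝ} (hU : Uᵀ * U = 1) (hV : Vᵀ * V = 1)
    (M : Matrix (Fin n) (Fin n) ℝ) :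
    ∑ i, ∑ j, (Uᵀ * M * V) i j ^ 2 = ∑ i, ∑ j, M i j ^ 2 := by
  have hU' : U * Uᵀ = 1 := mul_eq_one_comm.1 hU
  have hV' : V * Vᵀ = 1 := mul_eq_one_comm.1 hV
  rw [sum_sq_eq_trace, sum_sq_eq_trace]
  have : (Uᵀ * M * V)ᵀ * (Uᵀ * M * V) = Vᵀ * (Mᵀ * M * V) := by
    rw [Matrix.transpose_mul, Matrix.transpose_mul, Matrix.transpose_transpose]
    calc Vᵀ * (Mᵀ * U) * (Uᵀ * M * V) = Vᵀ * (Mᵀ * (U * Uᵀ) * M * V) := by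
          simp only [Matrix.mul_assoc]
      _ = Vᵀ * (Mᵀ * M * V) := by rw [hU', Matrix.mul_one]
  rw [this, Matrix.trace_mul_comm, Matrix.mul_assoc, hV', Matrix.mul_one]

/-- By Birkhoff's theorem the right side is a weighted mean of the values at permutations, hence at
least the smallest of them. -/
theorem exists_perm_sum_le {M : Matrix (Fin n) (Fin n) ℝ} (hM : M ∈ doublyStochastic ℝ (Fin n))
    (C : Fin n → Fin n → ℝ) :
    ∃ π : Equiv.Perm (Fin n), ∑ i, C i (π i) ≤ ∑ i, ∑ j, M i j * C i j := by
  obtain ⟨w, hw0, hw1, hwM⟩ := exists_eq_sum_perm_of_mem_doublyStochastic hM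
  set S := ∑ i, ∑ j, M i j * C i j with hS
  have hSum : ∑ π, w π * ∑ i, C i (π i) = S := by
    have : ∀ i j, M i j = ∑ π, w π * if π i = j then 1 else 0 := by
      intro i j
      rw [← hwM]
      simp [Matrix.sum_apply, Equiv.Perm.permMatrix, PEquiv.toMatrix_apply, Equiv.toPEquiv_apply,
        eq_comm]
    simp only [hS, this, Finset.sum_mul, Finset.mul_sum]
    rw [Finset.sum_comm]
    refine Finset.sum_congr rfl fun i _ => ?_
    rw [Finset.sum_comm]
    refine Finset.sum_congr rfl fun π _ => ?_
    simp
  by_contra! hcon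
  have h0 : ∑ π, w π * (∑ i, C i (π i) - S) = 0 := by
    simp only [mul_sub, Finset.sum_sub_distrib]
    rw [hSum, ← Finset.sum_mul, hw1]; ring
  rw [Finset.sum_eq_zero_iff_of_nonneg
    fun π _ => mul_nonneg (hw0 π) (sub_nonneg.2 (hcon π).le)] at h0
  have : ∀ π, w π = 0 := fun π => by
    rcases mul_eq_zero.1 (h0 π (Finset.mem_univ π)) with h | h
    · exact h
    · exact absurd h (sub_pos.2 (hcon π)).ne'
  simp [this] at hw1

theorem sq_mem_doublyStochastic {W : Matrix (Fin n) (Fin n) ℝ} (hW : Wᵀ * W = 1) :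
    Matrix.of (fun i j => W i j ^ 2) ∈ doublyStochastic ℝ (Fin n) := by
  have hW' : W * Wᵀ = 1 := mul_eq_one_comm.1 hW
  rw [mem_doublyStochastic_iff_sum]
  refine ⟨fun i j => sq_nonneg _, fun i => ?_, fun j => ?_⟩
  · have := congrFun (congrFun hW' i) i
    rw [Matrix.mul_apply, Matrix.one_apply_eq] at this
    simpa [sq] using this
  · have := congrFun (congrFun hW j) j
    rw [Matrix.mul_apply, Matrix.one_apply_eq] at this
    simpa [sq] using this

/-- The eigenvalues of two symmetric matrices, suitably ordered, are close. -/
theorem IsSpectral.exists_near {A U : Matrix (Fin n) (Fin n) ℝ} {l : Fin n → ℝ}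
    (h : IsSpectral A U l) {X V : Matrix (Fin n) (Fin n) ℝ} {m : Fin n → ℝ}
    (hX : IsSpectral X V m) :
    ∃ π : Equiv.Perm (Fin n), ∀ i, |m (π i) - l i| ≤ (n : ℝ) * ‖X - A‖ := by
  set W := Uᵀ * V with hW
  have hWo : Wᵀ * W = 1 := by
    rw [hW, Matrix.transpose_mul, Matrix.transpose_transpose, Matrix.mul_assoc,
      ← Matrix.mul_assoc U, h.orth', Matrix.one_mul, hX.orth]
  obtain ⟨π, hπ⟩ := exists_perm_sum_le (sq_mem_doublyStochastic hWo)
    fun i j => (m j - l i) ^ 2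
  refine ⟨π, fun i => ?_⟩
  -- In mixed eigenbases the squared Frobenius norm of X - A is linear in the doubly stochastic
  -- matrix (W_ij²), with costs (m_j - l_i)².
  have hent : ∀ i j, (Uᵀ * (X - A) * V) i j = W i j * (m j - l i) := by
    intro i j
    rw [Matrix.mul_sub, Matrix.sub_mul, h.transpose_mul, Matrix.mul_assoc, hX.mul_right,
      Matrix.mul_assoc, ← Matrix.mul_assoc, ← hW, Matrix.sub_apply, Matrix.mul_diagonal,
      Matrix.diagonal_mul]
    ring
  have h1 := sum_sq_conj h.orth hX.orth (X - A)
  simp only [hent, mul_pow] at h1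
  have h2 : ∑ i, ∑ j, (X - A) i j ^ 2 ≤ ((n : ℝ) * ‖X - A‖) ^ 2 := by
    have : ∀ i j, (X - A) i j ^ 2 ≤ ‖X - A‖ ^ 2 := fun i j => by
      rw [← sq_abs]
      exact pow_le_pow_left₀ (abs_nonneg _) (Matrix.norm_entry_le_entrywise_sup_norm (X - A)) 2
    refine (Finset.sum_le_sum fun i _ => Finset.sum_le_sum fun j _ => this i j).trans ?_
    simp only [Finset.sum_const, Finset.card_univ, Fintype.card_fin, nsmul_eq_mul]
    exact le_of_eq (by ring)
  have h3 : (m (π i) - l i) ^ 2 ≤ ∑ i, (m (π i) - l i) ^ 2 :=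
    Finset.single_le_sum (f := fun i => (m (π i) - l i) ^ 2) (fun k _ => sq_nonneg _)
      (Finset.mem_univ i)
  refine abs_le_of_sq_le_sq ?_ (mul_nonneg (Nat.cast_nonneg _) (norm_nonneg _))
  simp only [Matrix.of_apply] at hπ
  linarith

theorem IsSpectral.exists_near_eig {A U : Matrix (Fin n) (Fin n) ℝ} {l : Fin n → ℝ}
    (h : IsSpectral A U l) (X : SymMat n) :
    ∃ V m, IsSpectral (X : Matrix (Fin n) (Fin n) ℝ) V m ∧
      (∃ π : Equiv.Perm (Fin n), m = eig X ∘ π) ∧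
      ∀ i, |m i - l i| ≤ (n : ℝ) * ‖(X : Matrix (Fin n) (Fin n) ℝ) - A‖ := by
  obtain ⟨V, hV⟩ := exists_isSpectral X
  obtain ⟨π, hπ⟩ := h.exists_near hV
  exact ⟨_, _, hV.comp_perm π, ⟨π, rfl⟩, hπ⟩

/-- The perturbation estimate with X = A has right side 0, which gives uniqueness of the eigenvalues
up to order. -/
theorem IsSpectral.exists_perm_eig {A : SymMat n} {U : Matrix (Fin n) (Fin n) ℝ} {l : Fin n → ℝ}
    (h : IsSpectral (A : Matrix (Fin n) (Fin n) ℝ) U l) :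
    ∃ π : Equiv.Perm (Fin n), l = eig A ∘ π := by
  obtain ⟨V, m, -, ⟨π, hπ⟩, hm⟩ := h.exists_near_eig A
  refine ⟨π, ?_⟩
  rw [← hπ]
  ext i
  have := hm i
  rw [sub_self, norm_zero, mul_zero] at this
  linarith [abs_nonpos_iff.1 this]

/-! ### Hermite interpolation -/

/-- Lagrange interpolation fixes the values. The nodal polynomial has simple zeros at the nodes, so
a multiple of it corrects the derivatives without changing the values. -/
theorem exists_hermite (s : Finset ℝ) (a b : ℝ → ℝ) :
    ∃ q : ℝ[X], ∀ x ∈ s, q.eval x = a x ∧ q.derivative.eval x = b x := by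
  have hinj : Set.InjOn (id : ℝ → ℝ) s := Function.injective_id.injOn
  set q₀ := Lagrange.interpolate s id a with hq₀
  set N := Lagrange.nodal s (id : ℝ → ℝ) with hN
  set q₁ := Lagrange.interpolate s id
    (fun x => (b x - q₀.derivative.eval x) / N.derivative.eval x) with hq₁
  refine ⟨q₀ + N * q₁, fun x hx => ?_⟩
  have e0 : q₀.eval x = a x := Lagrange.eval_interpolate_at_node a hinj hx
  have e1 : q₁.eval x = (b x - q₀.derivative.eval x) / N.derivative.eval x :=
    Lagrange.eval_interpolate_at_node _ hinj hx
  have eN : N.eval x = 0 := Lagrange.eval_nodal_at_node (v := (id : ℝ → ℝ)) hx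
  have eN' : N.derivative.eval x ≠ 0 := by
    have := Lagrange.eval_nodal_derivative_eval_node_eq (v := (id : ℝ → ℝ)) hx
    simp only [id] at this
    rw [hN, this]
    refine Lagrange.eval_nodal_not_at_node fun y hy => ?_
    exact (Finset.ne_of_mem_erase hy).symm
  refine ⟨by simp [e0, eN], ?_⟩
  simp only [derivative_add, derivative_mul, eval_add, eval_mul, eN, e1]
  field_simp
  ring

/-! ### Derivatives of polynomials of a matrix -/

/-- The divided difference of a polynomial. -/
def divDiff (q : ℝ[X]) (a b : ℝ) : ℝ :=
  if a = b then q.derivative.eval a else (q.eval a - q.eval b) / (a - b)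

theorem divDiff_add (p q : ℝ[X]) (a b : ℝ) : divDiff (p + q) a b = divDiff p a b + divDiff q a b := by
  unfold divDiff
  split_ifs
  · simp
  · simp; ring

theorem divDiff_C (c a b : ℝ) : divDiff (C c) a b = 0 := by
  unfold divDiff
  simp

theorem divDiff_mul_X (q : ℝ[X]) (a b : ℝ) :
    divDiff (q * X) a b = q.eval a + divDiff q a b * b := by
  unfold divDiff
  split_ifs with h
  · subst h; simp; ring
  · have : a - b ≠ 0 := sub_ne_zero.2 h
    simp
    field_simp
    ring

/-- Induction on the degree: the product rule for q(X)·X, conjugated to the eigenbasis, is the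
recursion `divDiff_mul_X`. -/
theorem exists_hasFDerivAt_aeval {A : SymMat n} {U : Matrix (Fin n) (Fin n) ℝ} {l : Fin n → ℝ}
    (h : IsSpectral (A : Matrix (Fin n) (Fin n) ℝ) U l) (q : ℝ[X]) :
    ∃ L : SymMat n →L[ℝ] Matrix (Fin n) (Fin n) ℝ,
      HasFDerivAt (fun X : SymMat n => Polynomial.aeval (X : Matrix (Fin n) (Fin n) ℝ) q) L A ∧
      ∀ B k j, (Uᵀ * L B * U) k j =
        divDiff q (l k) (l j) * (Uᵀ * (B : Matrix (Fin n) (Fin n) ℝ) * U) k j := by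
  induction q using Polynomial.induction_on with
  | C a =>
    refine ⟨0, ?_, fun B k j => by simp [divDiff_C]⟩
    simpa using hasFDerivAt_const (𝕜 := ℝ) (algebraMap ℝ (Matrix (Fin n) (Fin n) ℝ) a) A
  | add p q hp hq =>
    obtain ⟨L, hL, hL'⟩ := hp
    obtain ⟨K, hK, hK'⟩ := hq
    refine ⟨L + K, ?_, fun B k j => ?_⟩
    · simp only [map_add]
      exact hL.fun_add hK
    · rw [add_apply, Matrix.mul_add, Matrix.add_mul, Matrix.add_apply, hL', hK', divDiff_add]
      ring
  | monomial m a ih =>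
    rw [pow_succ, ← mul_assoc]
    set q := C a * X ^ m with hq
    obtain ⟨L, hL, hL'⟩ := ih
    have hid : HasFDerivAt (fun X : SymMat n => (X : Matrix (Fin n) (Fin n) ℝ))
      (SymMat n).subtypeL A := (SymMat n).subtypeL.hasFDerivAt
    have hmul := (LinearMap.mul ℝ (Matrix (Fin n) (Fin n) ℝ)).toContinuousBilinearMap
      |>.hasFDerivAt_of_bilinear hL hid
    refine ⟨_, hmul.congr_of_eventuallyEq (Eventually.of_forall fun Y => ?_), ?_⟩
    · simp only [map_mul, aeval_X]
      rfl
    · intro B k j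
      change (Uᵀ * (Polynomial.aeval (A : Matrix (Fin n) (Fin n) ℝ) q *
        (B : Matrix (Fin n) (Fin n) ℝ) + L B * (A : Matrix (Fin n) (Fin n) ℝ)) * U) k j = _
      have e1 : Uᵀ * (Polynomial.aeval (A : Matrix (Fin n) (Fin n) ℝ) q *
          (B : Matrix (Fin n) (Fin n) ℝ)) * U =
          Matrix.diagonal (fun i => q.eval (l i)) * (Uᵀ * (B : Matrix (Fin n) (Fin n) ℝ) * U) := by
        rw [← Matrix.mul_assoc Uᵀ, (h.aeval q).transpose_mul]
        simp only [Matrix.mul_assoc]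
      have e2 : Uᵀ * (L B * (A : Matrix (Fin n) (Fin n) ℝ)) * U =
          Uᵀ * L B * U * Matrix.diagonal l := by
        rw [← Matrix.mul_assoc, Matrix.mul_assoc _ _ U, h.mul_right, ← Matrix.mul_assoc]
      rw [Matrix.mul_add, Matrix.add_mul, e1, e2, Matrix.add_apply, Matrix.diagonal_mul,
        Matrix.mul_diagonal, hL', divDiff_mul_X]
      ring

/-! ### Differentiability of `F` -/

theorem hasFDerivAt_of_isLittleO_sub {E W : Type*} [NormedAddCommGroup E] [NormedSpace ℝ E]
    [NormedAddCommGroup W] [NormedSpace ℝ W] {G M : E → W} {D : E →L[ℝ] W} {A : E}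
    (hM : HasFDerivAt M D A)
    (h : (fun X => (G X - M X) - (G A - M A)) =o[𝓝 A] fun X => X - A) : HasFDerivAt G D A := by
  rw [hasFDerivAt_iff_isLittleO] at hM ⊢
  refine (h.add hM).congr_left fun X => ?_
  abel

theorem hasFDerivAt_of_abs_sub_le {E : Type*} [NormedAddCommGroup E] [NormedSpace ℝ E]
    {G M : E → E →L[ℝ] ℝ} {D : E →L[ℝ] E →L[ℝ] ℝ} {A : E} {ρ : E → ℝ} (hM : HasFDerivAt M D A)
    (hρ0 : ∀ X, 0 ≤ ρ X) (hρ : ρ =o[𝓝 A] fun X => X - A)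
    (hb : ∀ᶠ X in 𝓝 A, ∀ C, |G X C - M X C| ≤ ρ X * ‖C‖) : HasFDerivAt G D A := by
  have hlit : (fun X => G X - M X) =o[𝓝 A] fun X => X - A := by
    refine IsBigO.trans_isLittleO (IsBigO.of_bound 1 ?_) hρ
    filter_upwards [hb] with X hX
    rw [one_mul, Real.norm_eq_abs, abs_of_nonneg (hρ0 X)]
    exact ContinuousLinearMap.opNorm_le_bound _ (hρ0 X) hX
  -- The little-o bound also holds at A itself, where the right side is 0.
  have h0 : G A - M A = 0 := by
    have := (hlit.bound zero_lt_one).self_of_nhds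
    simpa using this
  exact hasFDerivAt_of_isLittleO_sub hM (by simpa only [h0, sub_zero] using hlit)

theorem hasFDerivAt_add_sum_smul {E W : Type*} [NormedAddCommGroup E] [NormedSpace ℝ E]
    [NormedAddCommGroup W] [NormedSpace ℝ W]
    (S : W →L[ℝ] E →L[ℝ] ℝ) {φ : E → W} {φ' : E →L[ℝ] W} {A : E} (s : Finset ℝ) (g : ℝ → ℝ → ℝ)
    {ρ : ℝ → E → ℝ} {ρ' : ℝ → E →L[ℝ] ℝ} {χ : ℝ → E → W} {χ' : ℝ → E →L[ℝ] W}
    (hφ : HasFDerivAt φ φ' A) (hρ : ∀ ν, HasFDerivAt (ρ ν) (ρ' ν) A)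
    (hχ : ∀ μ, HasFDerivAt (χ μ) (χ' μ) A) :
    ∃ D : E →L[ℝ] E →L[ℝ] ℝ,
      HasFDerivAt (fun X => S (φ X) + ∑ μ ∈ s, ∑ ν ∈ s, (g μ ν * ρ ν X) • S (χ μ X)) D A ∧
      ∀ B C, D B C = S (φ' B) C + ∑ μ ∈ s, ∑ ν ∈ s,
        ((g μ ν * ρ ν A) * S (χ' μ B) C + (g μ ν * ρ' ν B) * S (χ μ A) C) := by
  have h := (S.hasFDerivAt.comp A hφ).fun_add
    (HasFDerivAt.fun_sum (u := s) fun μ _ => HasFDerivAt.fun_sum (u := s) fun ν _ =>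
      ((hρ ν).const_mul (g μ ν)).fun_smul (S.hasFDerivAt.comp A (hχ μ)))
  refine ⟨_, h, fun B C => ?_⟩
  simp [sum_apply]

theorem IsSpectral.mem_Gam {A : SymMat n} {U : Matrix (Fin n) (Fin n) ℝ} {l : Fin n → ℝ}
    (h : IsSpectral (A : Matrix (Fin n) (Fin n) ℝ) U l) : l ∈ Gam n α ↔ eig A ∈ Gam n α := by
  obtain ⟨π, rfl⟩ := h.exists_perm_eig
  refine ⟨fun H => ?_, fun H => comp_perm_mem_Gam H π⟩
  have := comp_perm_mem_Gam H π⁻¹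
  rwa [Function.comp_assoc, ← Equiv.Perm.coe_mul, mul_inv_cancel, Equiv.Perm.coe_one,
    Function.comp_id] at this

theorem IsSpectral.matFun_eq (hs : SymmetricOn α f) {A : SymMat n} {U : Matrix (Fin n) (Fin n) ℝ}
    {l : Fin n → ℝ} (h : IsSpectral (A : Matrix (Fin n) (Fin n) ℝ) U l) (hl : l ∈ Gam n α) :
    matFun f A = f l := by
  have hA : eig A ∈ Gam n α := h.mem_Gam.1 hl
  obtain ⟨π, rfl⟩ := h.exists_perm_eig
  exact (hs _ hA π).symm

/-- Only the ordered eigenvalues are controlled near A; the eigenbases V X are arbitrary. -/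
theorem IsSpectral.exists_selection {A : SymMat n} {U : Matrix (Fin n) (Fin n) ℝ} {l : Fin n → ℝ}
    (h : IsSpectral (A : Matrix (Fin n) (Fin n) ℝ) U l) :
    ∃ (V : SymMat n → Matrix (Fin n) (Fin n) ℝ) (m : SymMat n → Fin n → ℝ),
      (∀ X : SymMat n, IsSpectral (X : Matrix (Fin n) (Fin n) ℝ) (V X) (m X)) ∧
      ((fun X => m X - l) =O[𝓝 A] fun X => X - A) ∧ Tendsto m (𝓝 A) (𝓝 l) := by
  choose V m hV _ hm using fun X : SymMat n => h.exists_near_eig X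
  have hO : (fun X => m X - l) =O[𝓝 A] fun X => X - A := by
    refine IsBigO.of_bound (n : ℝ) (Eventually.of_forall fun X => ?_)
    have hX : 0 ≤ (n : ℝ) * ‖X - A‖ := mul_nonneg (Nat.cast_nonneg _) (norm_nonneg _)
    rw [pi_norm_le_iff_of_nonneg hX]
    exact fun i => hm X i
  refine ⟨V, m, hV, hO, ?_⟩
  have h0 : Tendsto (fun X => X - A) (𝓝 A) (𝓝 0) := by
    have : Continuous (fun X : SymMat n => X - A) := by fun_prop
    simpa using this.tendsto A
  have := hO.trans_tendsto h0
  simpa using this.add_const l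

/-- The pairing `(N, B) ↦ tr (N B)`. -/
def traceForm (n : ℕ) : Matrix (Fin n) (Fin n) ℝ →L[ℝ] SymMat n →L[ℝ] ℝ :=
  (LinearMap.mk₂ ℝ
    (fun (N : Matrix (Fin n) (Fin n) ℝ) (B : SymMat n) =>
      (N * (B : Matrix (Fin n) (Fin n) ℝ)).trace)
    (fun N N' B => by rw [Matrix.add_mul, Matrix.trace_add])
    (fun c N B => by rw [Matrix.smul_mul, Matrix.trace_smul])
    (fun N B B' => by rw [Submodule.coe_add, Matrix.mul_add, Matrix.trace_add])
    (fun c N B => by rw [Submodule.coe_smul, Matrix.mul_smul, Matrix.trace_smul])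
    ).toContinuousBilinearMap

theorem traceForm_apply (N : Matrix (Fin n) (Fin n) ℝ) (B : SymMat n) :
    traceForm n N B = (N * (B : Matrix (Fin n) (Fin n) ℝ)).trace := rfl

theorem IsSpectral.traceForm_apply {N U : Matrix (Fin n) (Fin n) ℝ} {l : Fin n → ℝ}
    (h : IsSpectral N U l) (B : SymMat n) :
    traceForm n N B = ∑ i, l i * (Uᵀ * (B : Matrix (Fin n) (Fin n) ℝ) * U) i i :=
  h.trace_mul_eq _

theorem trace_conj {U : Matrix (Fin n) (Fin n) ℝ} (hU : Uᵀ * U = 1)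
    (N : Matrix (Fin n) (Fin n) ℝ) : N.trace = ∑ k, (Uᵀ * N * U) k k := by
  have hU' : U * Uᵀ = 1 := mul_eq_one_comm.1 hU
  have : (Uᵀ * N * U).trace = N.trace := by
    rw [Matrix.trace_mul_comm, ← Matrix.mul_assoc, hU', Matrix.one_mul]
  rw [← this]; rfl

theorem hasFDerivAt_eval_apply (q : ℝ[X]) (l : Fin n → ℝ) (i : Fin n) :
    HasFDerivAt (fun m : Fin n → ℝ => q.eval (m i))
      (q.derivative.eval (l i) • ContinuousLinearMap.proj (R := ℝ) (φ := fun _ : Fin n => ℝ) i) l :=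
  HasDerivAt.comp_hasFDerivAt (h₂ := fun y => q.eval y) l (q.hasDerivAt (l i))
    (hasFDerivAt_apply (𝕜 := ℝ) i l)

theorem exists_hasFDerivAt_trace_aeval {A : SymMat n} {U : Matrix (Fin n) (Fin n) ℝ}
    {l : Fin n → ℝ} (h : IsSpectral (A : Matrix (Fin n) (Fin n) ℝ) U l) (q : ℝ[X]) :
    ∃ L : SymMat n →L[ℝ] ℝ,
      HasFDerivAt (fun X : SymMat n => (aeval (X : Matrix (Fin n) (Fin n) ℝ) q).trace) L A ∧
      ∀ B : SymMat n, L B =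
        ∑ k, q.derivative.eval (l k) * (Uᵀ * (B : Matrix (Fin n) (Fin n) ℝ) * U) k k := by
  obtain ⟨L, hL, hL'⟩ := exists_hasFDerivAt_aeval h q
  set tr : Matrix (Fin n) (Fin n) ℝ →L[ℝ] ℝ :=
    LinearMap.toContinuousLinearMap (Matrix.traceLinearMap (Fin n) ℝ ℝ)
  refine ⟨tr.comp L, tr.hasFDerivAt.comp A hL, fun B => ?_⟩
  change (L B).trace = _
  rw [trace_conj h.orth]
  refine Finset.sum_congr rfl fun k _ => ?_
  rw [hL', divDiff, if_pos rfl]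

theorem exists_factor {l p : Fin n → ℝ} (h : ∀ i j, l i = l j → p i = p j) :
    ∃ b : ℝ → ℝ, ∀ i, b (l i) = p i :=
  ⟨Function.extend l p 0, fun i => Function.FactorsThrough.extend_apply (fun i j hij => h i j hij) 0 i⟩

/-- Choose q with q'(l_i) = ∂_i f(l). Then F - tr q(X) is the function f - ∑ q(x_i) of the
eigenvalues, whose differential vanishes at l; as the eigenvalues move by O(X - A), F has the
derivative of tr q(X). -/
theorem hasFDerivAt_matFun (hf : ContDiffOn ℝ ∞ f (Gam n α)) (hs : SymmetricOn α f) {A : SymMat n}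
    {U : Matrix (Fin n) (Fin n) ℝ} {l : Fin n → ℝ}
    (h : IsSpectral (A : Matrix (Fin n) (Fin n) ℝ) U l) (hl : l ∈ Gam n α) :
    HasFDerivAt (matFun f) (traceForm n (U * Matrix.diagonal (d1 f l) * Uᵀ)) A := by
  obtain ⟨b, hb⟩ := exists_factor (l := l) (p := d1 f l) fun i j hij => d1_eq_of_eq hf hs hl hij
  obtain ⟨q, hq⟩ := exists_hermite (Finset.univ.image l) (fun _ => 0) b
  have hq' : ∀ i, q.derivative.eval (l i) = d1 f l i := fun i => by
    rw [(hq (l i) (Finset.mem_image_of_mem l (Finset.mem_univ i))).2, hb]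
  obtain ⟨L, hL, hL'⟩ := exists_hasFDerivAt_trace_aeval h q
  obtain ⟨V, m, hV, hO, hm⟩ := h.exists_selection
  have hψ : HasFDerivAt (fun x : Fin n → ℝ => f x - ∑ i, q.eval (x i))
      (0 : (Fin n → ℝ) →L[ℝ] ℝ) l := by
    refine ((hasFDerivAt_of_smooth hf hl).sub
      (HasFDerivAt.fun_sum fun i _ => hasFDerivAt_eval_apply q l i)).congr_fderiv ?_
    ext η
    rw [sub_apply, fderiv_apply_eq_sum, sum_apply]
    simp [hq']
  have hLeq : L = traceForm n (U * Matrix.diagonal (d1 f l) * Uᵀ) := by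
    refine ContinuousLinearMap.ext fun B => ?_
    rw [hL', IsSpectral.traceForm_apply ⟨h.orth, rfl⟩]
    simp only [hq']
  rw [← hLeq]
  refine hasFDerivAt_of_isLittleO_sub hL ?_
  rw [hasFDerivAt_iff_isLittleO] at hψ
  refine ((hψ.comp_tendsto hm).trans_isBigO hO).congr' ?_ EventuallyEq.rfl
  filter_upwards [hm (isOpen_Gam.mem_nhds hl)] with X hX
  have e1 := (hV X).matFun_eq hs hX
  have e2 := h.matFun_eq hs hl
  have e3 := ((hV X).aeval q).trace_eq
  have e4 := (h.aeval q).trace_eq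
  simp only [Function.comp_apply, e1, e2, e3, e4, zero_apply, sub_zero]

theorem exists_d2_factor (hf : ContDiffOn ℝ ∞ f (Gam n α)) (hs : SymmetricOn α f) {l : Fin n → ℝ}
    (hl : l ∈ Gam n α) : ∃ (d : ℝ → ℝ) (h : ℝ → ℝ → ℝ),
      ∀ i j, d2 f l i j = h (l i) (l j) + if i = j then d (l i) else 0 := by
  classical
  -- The value at (a, b) is read off from any two distinct indices carrying these eigenvalues. If a
  -- is simple then h a a = 0, and d takes the whole diagonal entry.
  let h : ℝ → ℝ → ℝ := fun a b =>
    if H : ∃ ij : Fin n × Fin n, ij.1 ≠ ij.2 ∧ l ij.1 = a ∧ l ij.2 = b then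
      d2 f l H.choose.1 H.choose.2 else 0
  have hh : ∀ i j, i ≠ j → h (l i) (l j) = d2 f l i j := by
    intro i j hij
    have H : ∃ ij : Fin n × Fin n, ij.1 ≠ ij.2 ∧ l ij.1 = l i ∧ l ij.2 = l j :=
      ⟨(i, j), hij, rfl, rfl⟩
    simp only [h, dif_pos H]
    obtain ⟨h1, h2, h3⟩ := H.choose_spec
    exact d2_offDiag_eq_of_eq hf hs hl h2 h3 h1 hij
  obtain ⟨d, hd⟩ := exists_factor (l := l) (p := fun i => d2 f l i i - h (l i) (l i))
    fun i j hij => by rw [d2_diag_eq_of_eq hf hs hl hij, hij]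
  refine ⟨d, h, fun i j => ?_⟩
  by_cases hij : i = j
  · subst hij; rw [if_pos rfl, hd]; ring
  · rw [if_neg hij, hh i j hij, add_zero]

/-- The coefficients of the off-diagonal entries in the second derivative of `F`. -/
def offCoef (f : (Fin n → ℝ) → ℝ) (l : Fin n → ℝ) (k j : Fin n) : ℝ :=
  if l k = l j then d2 f l k k - d2 f l k j else (d1 f l k - d1 f l j) / (l k - l j)

theorem sum_sum_mul_sum (s : Finset ℝ) (g : ℝ → ℝ → ℝ) (R : ℝ → ℝ) (E : ℝ → Fin n → ℝ)
    (w : Fin n → ℝ) :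
    ∑ μ ∈ s, ∑ ν ∈ s, (g μ ν * R ν) * ∑ i, E μ i * w i =
      ∑ i, (∑ μ ∈ s, ∑ ν ∈ s, g μ ν * (R ν * E μ i)) * w i := by
  simp only [Finset.sum_mul]
  rw [Finset.sum_comm (s := Finset.univ)]
  refine Finset.sum_congr rfl fun μ _ => ?_
  rw [Finset.sum_comm (s := Finset.univ)]
  refine Finset.sum_congr rfl fun ν _ => ?_
  rw [Finset.mul_sum]
  exact Finset.sum_congr rfl fun i _ => by ring

/-- At A, `e μ` yields the spectral projection onto the μ-eigenspace, and the trace of `r ν` yields,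
to first order, the total displacement of the eigenvalues near ν. -/
theorem exists_hermite_family (s : Finset ℝ) :
    ∃ e r : ℝ → ℝ[X], ∀ μ, ∀ x ∈ s,
      (e μ).eval x = (if x = μ then 1 else 0) ∧ (e μ).derivative.eval x = 0 ∧
      (r μ).eval x = 0 ∧ (r μ).derivative.eval x = if x = μ then 1 else 0 := by
  choose e he using fun μ : ℝ => exists_hermite s (fun x => if x = μ then 1 else 0) fun _ => 0
  choose r hr using fun μ : ℝ => exists_hermite s (fun _ => 0) (fun x => if x = μ then 1 else 0)
  exact ⟨e, r, fun μ x hx => ⟨(he μ x hx).1, (he μ x hx).2, (hr μ x hx).1, (hr μ x hx).2⟩⟩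

/-- The gradient of F is modelled by q(X) + ∑ g(μ,ν) tr r_ν(X) e_μ(X). Differentiating q gives the
divided differences, hence the off-diagonal coefficients; differentiating tr r_ν gives the mixed
second derivatives of f. -/
theorem exists_hasFDerivAt_fderiv_matFun (hf : ContDiffOn ℝ ∞ f (Gam n α)) (hs : SymmetricOn α f)
    {A : SymMat n} {U : Matrix (Fin n) (Fin n) ℝ} {l : Fin n → ℝ}
    (h : IsSpectral (A : Matrix (Fin n) (Fin n) ℝ) U l) (hl : l ∈ Gam n α) :
    ∃ D : SymMat n →L[ℝ] SymMat n →L[ℝ] ℝ,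
      HasFDerivAt (fun X : SymMat n => fderiv ℝ (matFun f) X) D A ∧
      ∀ B : SymMat n, D B B = specQuad (d2 f l) (offCoef f l)
        (Uᵀ * (B : Matrix (Fin n) (Fin n) ℝ) * U) := by
  obtain ⟨d, g, hdg⟩ := exists_d2_factor hf hs hl
  obtain ⟨b, hb⟩ := exists_factor (l := l) (p := d1 f l) fun i j hij => d1_eq_of_eq hf hs hl hij
  set s := Finset.univ.image l with hsdef
  have hls : ∀ i, l i ∈ s := fun i => Finset.mem_image_of_mem l (Finset.mem_univ i)
  obtain ⟨q, hq⟩ := exists_hermite s b d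
  obtain ⟨e, r, her⟩ := exists_hermite_family s
  have hqv : ∀ i, q.eval (l i) = d1 f l i := fun i => by rw [(hq _ (hls i)).1, hb]
  have hqd : ∀ i, q.derivative.eval (l i) = d (l i) := fun i => (hq _ (hls i)).2
  have hsum : ∀ (φ : ℝ → ℝ) i, ∑ μ ∈ s, (if l i = μ then 1 else 0) * φ μ = φ (l i) := by
    intro φ i
    simp [hls i]
  -- The i-th eigenvalue of the gradient minus that of the model; it vanishes to first order at l.
  let Ψ : Fin n → (Fin n → ℝ) → ℝ := fun i x =>
    d1 f x i - q.eval (x i) - ∑ μ ∈ s, ∑ ν ∈ s, g μ ν * ((∑ j, (r ν).eval (x j)) * (e μ).eval (x i))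
  have hΨ0 : ∀ i, Ψ i l = 0 := by
    intro i
    simp only [Ψ, hqv, sub_self, zero_sub, neg_eq_zero]
    refine Finset.sum_eq_zero fun μ _ => Finset.sum_eq_zero fun ν _ => ?_
    rw [Finset.sum_eq_zero fun j _ => (her ν _ (hls j)).2.2.1]
    ring
  have hΨ : ∀ i, HasFDerivAt (Ψ i) (0 : (Fin n → ℝ) →L[ℝ] ℝ) l := by
    intro i
    have h1 := ((hasFDerivAt_d1 hf hl i).sub (hasFDerivAt_eval_apply q l i)).sub
      (HasFDerivAt.fun_sum (u := s) fun μ _ => HasFDerivAt.fun_sum (u := s) fun ν _ =>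
        ((HasFDerivAt.fun_sum (u := Finset.univ) fun j _ =>
          hasFDerivAt_eval_apply (r ν) l j).mul (hasFDerivAt_eval_apply (e μ) l i)).const_mul (g μ ν))
    refine h1.congr_fderiv ?_
    ext η
    have e1 : ∀ ν, ∑ j, (r ν).eval (l j) = 0 := fun ν =>
      Finset.sum_eq_zero fun j _ => (her ν _ (hls j)).2.2.1
    have e2 : ∑ μ ∈ s, ∑ ν ∈ s, g μ ν * ((if l i = μ then 1 else 0) *
        ∑ j, (if l j = ν then 1 else 0) * η j) = ∑ j, g (l i) (l j) * η j := by
      have : ∀ μ, ∑ ν ∈ s, g μ ν * ((if l i = μ then 1 else 0) *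
          ∑ j, (if l j = ν then 1 else 0) * η j) =
          (if l i = μ then 1 else 0) * ∑ j, g μ (l j) * η j := by
        intro μ
        simp only [Finset.mul_sum]
        rw [Finset.sum_comm]
        refine Finset.sum_congr rfl fun j _ => ?_
        rw [← hsum (fun ν => (if l i = μ then 1 else 0) * (g μ ν * η j)) j]
        exact Finset.sum_congr rfl fun ν _ => by ring
      simp only [this]
      exact hsum (fun μ => ∑ j, g μ (l j) * η j) i
    have e3 : ∑ j, d2 f l i j * η j = ∑ j, g (l i) (l j) * η j + d (l i) * η i := by
      simp only [hdg, add_mul, Finset.sum_add_distrib, ite_mul, zero_mul, Finset.sum_ite_eq,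
        Finset.mem_univ, if_true]
    simp only [sub_apply, sum_apply, smul_apply, add_apply, ContinuousLinearMap.proj_apply,
      smul_eq_mul, zero_apply, e1, zero_mul, zero_add, hqd]
    simp only [fun μ j => (her μ _ (hls j)).1, fun μ j => (her μ _ (hls j)).2.2.2]
    rw [e2, e3]
    ring
  obtain ⟨V, m, hV, hO, hm⟩ := h.exists_selection
  obtain ⟨Lq, hLq, hLq'⟩ := exists_hasFDerivAt_aeval h q
  choose Le hLe hLe' using fun μ => exists_hasFDerivAt_aeval h (e μ)
  choose Lr hLr hLr' using fun ν => exists_hasFDerivAt_trace_aeval h (r ν)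
  obtain ⟨D, hD, hD'⟩ := hasFDerivAt_add_sum_smul (traceForm n) s g hLq hLr hLe
  refine ⟨D, ?_, fun B => ?_⟩
  · refine hasFDerivAt_of_abs_sub_le (ρ := fun X => ∑ i, ((n : ℝ) * n) * ‖Ψ i (m X)‖) hD
      (fun X => Finset.sum_nonneg fun i _ => by positivity) ?_ ?_
    · have hlit : ∀ i, (fun X => Ψ i (m X)) =o[𝓝 A] fun X => X - A := by
        intro i
        have h2 := hΨ i
        rw [hasFDerivAt_iff_isLittleO] at h2
        have h3 := (h2.comp_tendsto hm).trans_isBigO hO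
        refine h3.congr' (Eventually.of_forall fun X => ?_) EventuallyEq.rfl
        simp [hΨ0]
      have hlit' : ∀ i ∈ (Finset.univ : Finset (Fin n)),
          (fun X => ((n : ℝ) * n) * ‖Ψ i (m X)‖) =o[𝓝 A] fun X => X - A :=
        fun i _ => (hlit i).norm_left.const_mul_left _
      exact IsLittleO.fun_sum hlit'
    · filter_upwards [hm (isOpen_Gam.mem_nhds hl)] with X hX C
      have key : fderiv ℝ (matFun f) X C - (traceForm n (aeval (X : Matrix (Fin n) (Fin n) ℝ) q) C +
          ∑ μ ∈ s, ∑ ν ∈ s, (g μ ν * (aeval (X : Matrix (Fin n) (Fin n) ℝ) (r ν)).trace) *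
            traceForm n (aeval (X : Matrix (Fin n) (Fin n) ℝ) (e μ)) C) =
          ∑ i, Ψ i (m X) * ((V X)ᵀ * (C : Matrix (Fin n) (Fin n) ℝ) * V X) i i := by
        rw [(hasFDerivAt_matFun hf hs (hV X) hX).fderiv,
          IsSpectral.traceForm_apply ⟨(hV X).orth, rfl⟩, ((hV X).aeval q).traceForm_apply]
        simp only [fun μ => ((hV X).aeval (e μ)).traceForm_apply C,
          fun ν => ((hV X).aeval (r ν)).trace_eq, Ψ, sub_mul, Finset.sum_sub_distrib]
        rw [sub_sub]
        rw [sum_sum_mul_sum]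
      have e0 : (traceForm n (aeval (X : Matrix (Fin n) (Fin n) ℝ) q) +
          ∑ μ ∈ s, ∑ ν ∈ s, (g μ ν * (aeval (X : Matrix (Fin n) (Fin n) ℝ) (r ν)).trace) •
            traceForm n (aeval (X : Matrix (Fin n) (Fin n) ℝ) (e μ))) C =
          traceForm n (aeval (X : Matrix (Fin n) (Fin n) ℝ) q) C +
          ∑ μ ∈ s, ∑ ν ∈ s, (g μ ν * (aeval (X : Matrix (Fin n) (Fin n) ℝ) (r ν)).trace) *
            traceForm n (aeval (X : Matrix (Fin n) (Fin n) ℝ) (e μ)) C := by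
        simp [sum_apply]
      have hle : |fderiv ℝ (matFun f) X C -
          (traceForm n (aeval (X : Matrix (Fin n) (Fin n) ℝ) q) +
          ∑ μ ∈ s, ∑ ν ∈ s, (g μ ν * (aeval (X : Matrix (Fin n) (Fin n) ℝ) (r ν)).trace) •
            traceForm n (aeval (X : Matrix (Fin n) (Fin n) ℝ) (e μ))) C| ≤
          (∑ i, ((n : ℝ) * n) * ‖Ψ i (m X)‖) * ‖(C : Matrix (Fin n) (Fin n) ℝ)‖ := by
        rw [e0, key, Finset.sum_mul]
        refine (Finset.abs_sum_le_sum_abs _ _).trans (Finset.sum_le_sum fun i _ => ?_)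
        rw [abs_mul]
        have h3 := (hV X).abs_conj_diag_le (C : Matrix (Fin n) (Fin n) ℝ) i
        refine (mul_le_mul_of_nonneg_left h3 (abs_nonneg (Ψ i (m X)))).trans (le_of_eq ?_)
        rw [Real.norm_eq_abs]
        ring
      exact hle
  · set B' := Uᵀ * (B : Matrix (Fin n) (Fin n) ℝ) * U with hB'
    have hBs : ∀ k j, B' j k = B' k j := by
      have : B'ᵀ = B' := by
        have hB : (B : Matrix (Fin n) (Fin n) ℝ)ᵀ = B := B.2
        rw [hB', Matrix.transpose_mul, Matrix.transpose_mul, Matrix.transpose_transpose, hB,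
          Matrix.mul_assoc]
      exact fun k j => congrFun (congrFun this k) j
    have e1 : traceForm n (Lq B) B = ∑ k, ∑ j, divDiff q (l k) (l j) * B' k j ^ 2 := by
      rw [CurvaturePinching.traceForm_apply, trace_conj h.orth]
      have : Uᵀ * (Lq B * (B : Matrix (Fin n) (Fin n) ℝ)) * U = Uᵀ * Lq B * U * B' := by
        rw [hB']
        calc _ = Uᵀ * Lq B * 1 * (B : Matrix (Fin n) (Fin n) ℝ) * U := by
              simp only [Matrix.mul_assoc, Matrix.mul_one]
          _ = _ := by rw [← h.orth']; simp only [Matrix.mul_assoc]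
      rw [this]
      refine Finset.sum_congr rfl fun k _ => ?_
      rw [Matrix.mul_apply]
      refine Finset.sum_congr rfl fun j _ => ?_
      rw [hLq', ← hB', hBs k j]
      ring
    have e2 : ∑ μ ∈ s, ∑ ν ∈ s, (g μ ν * Lr ν B) *
        traceForm n (aeval (A : Matrix (Fin n) (Fin n) ℝ) (e μ)) B =
        ∑ k, ∑ j, g (l k) (l j) * B' k k * B' j j := by
      simp only [hLr', fun μ => (h.aeval (e μ)).traceForm_apply B, ← hB',
        fun μ j => (her μ _ (hls j)).1, fun μ j => (her μ _ (hls j)).2.2.2]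
      have h1 : ∀ μ, ∑ ν ∈ s, g μ ν * (∑ j, (if l j = ν then 1 else 0) * B' j j) =
          ∑ j, g μ (l j) * B' j j := by
        intro μ
        simp only [Finset.mul_sum]
        rw [Finset.sum_comm]
        refine Finset.sum_congr rfl fun j _ => ?_
        rw [← hsum (fun ν => g μ ν * B' j j) j]
        exact Finset.sum_congr rfl fun ν _ => by ring
      simp only [← Finset.sum_mul, h1]
      rw [Finset.sum_congr rfl fun μ _ => Finset.mul_sum _ _ _]
      rw [Finset.sum_comm]
      refine Finset.sum_congr rfl fun k _ => ?_
      have h2 : ∑ j, g (l k) (l j) * B' k k * B' j j =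
          (fun μ => (∑ j, g μ (l j) * B' j j) * B' k k) (l k) := by
        simp only [Finset.sum_mul]
        exact Finset.sum_congr rfl fun j _ => by ring
      rw [h2]
      refine Eq.trans ?_ (hsum (fun μ => (∑ j, g μ (l j) * B' j j) * B' k k) k)
      exact Finset.sum_congr rfl fun μ _ => by ring
    -- Because tr r_ν(A) = 0, the derivatives of e_μ(X) do not contribute.
    have e3 : ∀ ν, (aeval (A : Matrix (Fin n) (Fin n) ℝ) (r ν)).trace = 0 := fun ν => by
      rw [(h.aeval (r ν)).trace_eq]
      exact Finset.sum_eq_zero fun j _ => (her ν _ (hls j)).2.2.1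
    have e4 : D B B = traceForm n (Lq B) B + ∑ μ ∈ s, ∑ ν ∈ s, (g μ ν * Lr ν B) *
        traceForm n (aeval (A : Matrix (Fin n) (Fin n) ℝ) (e μ)) B := by
      refine (hD' B B).trans (congrArg₂ _ rfl ?_)
      refine Finset.sum_congr rfl fun μ _ => Finset.sum_congr rfl fun ν _ => ?_
      rw [e3, mul_zero, zero_mul, zero_add]
      rfl
    refine e4.trans ?_
    rw [e1, e2]
    unfold specQuad
    rw [← Finset.sum_add_distrib, ← Finset.sum_add_distrib]
    refine Finset.sum_congr rfl fun k _ => ?_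
    rw [← Finset.sum_add_distrib, ← Finset.sum_add_distrib]
    refine Finset.sum_congr rfl fun j _ => ?_
    rw [hdg k j]
    by_cases hkj : k = j
    · subst hkj
      rw [if_pos rfl, if_pos rfl, divDiff, if_pos rfl, hqd]
      ring
    · rw [if_neg hkj, if_neg hkj]
      have : divDiff q (l k) (l j) = offCoef f l k j := by
        unfold divDiff offCoef
        split_ifs with hl'
        · rw [hqd, hdg, hdg, if_pos rfl, if_neg hkj, hl']; ring
        · rw [hqv, hqv]
      rw [this]
      ring

/-! ### Bounds for the coefficients of the second derivative -/

theorem sum_sum_single_sub_single (H : Fin n → Fin n → ℝ) (k j : Fin n) :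
    ∑ a, ∑ b, H a b * (Pi.single k 1 - Pi.single j 1 : Fin n → ℝ) a *
      (Pi.single k 1 - Pi.single j 1 : Fin n → ℝ) b = H k k - H k j - H j k + H j j := by
  simp [Pi.single_apply, mul_sub, Finset.sum_sub_distrib]
  ring

theorem offCoef_comm (hf : ContDiffOn ℝ ∞ f (Gam n α)) (hs : SymmetricOn α f) {l : Fin n → ℝ}
    (hl : l ∈ Gam n α) (k j : Fin n) : offCoef f l k j = offCoef f l j k := by
  unfold offCoef
  by_cases h : l k = l j
  · rw [if_pos h, if_pos h.symm, d2_diag_eq_of_eq hf hs hl h, d2_comm hf hl k j]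
  · rw [if_neg h, if_neg (Ne.symm h), ← neg_sub (l j), ← neg_sub (d1 f l j), neg_div_neg_eq]

theorem offCoef_nonpos (hf : ContDiffOn ℝ ∞ f (Gam n α)) (hs : SymmetricOn α f)
    (hc : ConcaveOn ℝ (Gam n α) f) {l : Fin n → ℝ} (hl : l ∈ Gam n α) (k j : Fin n) :
    offCoef f l k j ≤ 0 := by
  unfold offCoef
  split_ifs with h
  · have h1 := d2_quadratic_nonpos hf hc hl (Pi.single k 1 - Pi.single j 1)
    rw [sum_sum_single_sub_single, ← d2_diag_eq_of_eq hf hs hl h, d2_comm hf hl j k] at h1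
    linarith
  · have h1 := d1_sub_mul_sub_nonpos hf hs hc hl k j
    have h2 : l k - l j ≠ 0 := sub_ne_zero.2 h
    have h3 : (d1 f l k - d1 f l j) / (l k - l j) =
        (d1 f l k - d1 f l j) * (l k - l j) / (l k - l j) ^ 2 := by field_simp
    rw [h3]
    exact div_nonpos_of_nonpos_of_nonneg h1 (sq_nonneg _)

/-- For equal eigenvalues test the second-order inequality with e_k - e_j; otherwise the difference
of the two sides is a positive multiple of the first-order swapping inequality. -/
theorem neg_le_offCoef (hσα : σ ≤ α) (hf : ContDiffOn ℝ ∞ f (Gam n α)) (hs : SymmetricOn α f)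
    (hi : InverseConcaveOn α σ f) {l : Fin n → ℝ} (hl : l ∈ Gam n α) {k j : Fin n} (hkj : k ≠ j) :
    -(d1 f l k / (l j - σ) + d1 f l j / (l k - σ)) ≤ offCoef f l k j := by
  have hpos : ∀ i, 0 < l i - σ := fun i => by linarith [hl i]
  unfold offCoef
  split_ifs with h
  · have h1 := inverse_d2_quadratic_nonneg hσα hf hi hl (Pi.single k 1 - Pi.single j 1)
    rw [sum_sum_single_sub_single, ← d2_diag_eq_of_eq hf hs hl h, d2_comm hf hl j k,
      Finset.sum_eq_add k j hkj] at h1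
    · simp only [Pi.sub_apply, Pi.single_eq_same, Pi.single_eq_of_ne hkj,
        Pi.single_eq_of_ne hkj.symm] at h1
      rw [h] at h1 ⊢
      norm_num at h1
      linarith
    · intro i _ hi
      simp [hi.1, hi.2]
    · simp
    · simp
  · have h1 := inverse_d1_sub_mul_sub_nonneg hσα hf hs hi hl k j
    have h2 : l k - l j ≠ 0 := sub_ne_zero.2 h
    have h3 := (hpos k).ne'
    have h4 := (hpos j).ne'
    have h5 : (d1 f l k - d1 f l j) / (l k - l j) +
        (d1 f l k / (l j - σ) + d1 f l j / (l k - σ)) =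
        (l k - l j) * (d1 f l k * (l k - σ) ^ 2 - d1 f l j * (l j - σ) ^ 2) /
          ((l k - l j) ^ 2 * ((l k - σ) * (l j - σ))) := by
      field_simp
      ring
    have h6 : 0 ≤ (l k - l j) * (d1 f l k * (l k - σ) ^ 2 - d1 f l j * (l j - σ) ^ 2) /
        ((l k - l j) ^ 2 * ((l k - σ) * (l j - σ))) :=
      div_nonneg h1 (mul_nonneg (sq_nonneg _) (mul_nonneg (hpos k).le (hpos j).le))
    linarith

/-- As σ ≤ α, inverse concavity based at σ gives bounds with 1/(l_k - σ) ≤ 1/(l_k - α), hence those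
needed for x_k = l_k - α. The degenerate case is that of constant f. -/
theorem exists_spec_nonneg (hσα : σ ≤ α) (hf : ContDiffOn ℝ ∞ f (Gam n α))
    (hs : SymmetricOn α f) (hm : MonotoneOn f (Gam n α)) (hc : ConcaveOn ℝ (Gam n α) f)
    (hi : InverseConcaveOn α σ f) {l : Fin n → ℝ} (hl : l ∈ Gam n α) {o : Fin n}
    (ho : ∀ k, l o ≤ l k) {T : Fin n → Fin n → Fin n → ℝ} (hT : TotallySymmetric T) {ε : ℝ}
    (hε : ε * ∑ k, (l k - α) = l o - α) (hε0 : 0 ≤ ε) (hε1 : ε ≤ 1) :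
    ∃ g, 0 ≤ specQuad (d2 f l) (offCoef f l) (T o)
        - ε * ∑ a, specQuad (d2 f l) (offCoef f l) (T a)
        + 2 * specGamma o ε (fun k => l k - α) (d1 f l) T g := by
  have hx : ∀ k, 0 < l k - α := fun k => sub_pos.2 (hl k)
  have hp0 := d1_nonneg hf hm hl
  have hle : ∀ i j, d1 f l i / (l j - σ) ≤ d1 f l i / (l j - α) := fun i j =>
    div_le_div_of_nonneg_left (hp0 i) (hx j) (by linarith)
  by_cases hp : ∀ k, 0 < d1 f l k
  · refine exists_specGamma_nonneg o hT hx (fun k => by linarith [ho k]) hp hε hε0 hε1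
      (offCoef_comm hf hs hl) (fun k j _ => offCoef_nonpos hf hs hc hl k j)
      (fun k j hkj => ?_) (fun k j => ?_) (d2_quadratic_nonpos hf hc hl) (fun η => ?_)
    · have := neg_le_offCoef hσα hf hs hi hl hkj
      linarith [hle k j, hle j k]
    · by_cases h : l k = l j
      · exact Or.inr (by rw [h])
      · left
        have : l k - l j ≠ 0 := sub_ne_zero.2 h
        rw [offCoef, if_neg h, sub_sub_sub_cancel_right, div_mul_cancel₀ _ this]
    · have h1 := inverse_d2_quadratic_nonneg hσα hf hi hl η
      have h2 : ∑ k, d1 f l k * η k ^ 2 / (l k - σ) ≤ ∑ k, d1 f l k * η k ^ 2 / (l k - α) :=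
        Finset.sum_le_sum fun k _ =>
          div_le_div_of_nonneg_left (mul_nonneg (hp0 k) (sq_nonneg _)) (hx k) (by linarith)
      linarith
  · push Not at hp
    obtain ⟨k, hk⟩ := hp
    have hk0 : d1 f l k = 0 := le_antisymm hk (hp0 k)
    have hconst : ∀ y ∈ Gam n α, f =ᶠ[𝓝 y] fun _ => f l := fun y hy => by
      filter_upwards [isOpen_Gam.mem_nhds hy] with z hz
      exact eq_of_d1_eq_zero hσα hf hs hc hi hl hk0 hz
    have hfd : ∀ y ∈ Gam n α, fderiv ℝ f y = 0 := fun y hy => by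
      rw [(hconst y hy).fderiv_eq, fderiv_const_apply]
    have hd1 : d1 f l = 0 := by ext i; simp [d1, hfd l hl]
    have hd2 : ∀ i j, d2 f l i j = 0 := fun i j => by
      have : (fun x => fderiv ℝ f x) =ᶠ[𝓝 l] fun _ => 0 := by
        filter_upwards [isOpen_Gam.mem_nhds hl] with z hz using hfd z hz
      simp [d2, this.fderiv_eq]
    have hoff : ∀ i j, offCoef f l i j = 0 := fun i j => by simp [offCoef, hd1, hd2]
    refine ⟨0, ?_⟩
    simp [specQuad, specGamma, hd1, hd2, hoff]

/-! ### An eigenbasis that contains a given eigenvector -/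


theorem exists_isSpectral_min {A : SymMat n} {v : Fin n → ℝ} (hv : IsMinEigenvector A v) :
    ∃ (U : Matrix (Fin n) (Fin n) ℝ) (l : Fin n → ℝ) (o : Fin n) (ρ : ℝ),
      IsSpectral (A : Matrix (Fin n) (Fin n) ℝ) U l ∧ 0 < ρ ∧ (∀ i, v i = ρ * U i o) ∧
      ∀ k, l o ≤ l k := by
  obtain ⟨hv0, μ, hμ, hmin⟩ := hv
  obtain ⟨U, hU⟩ := exists_isSpectral A
  obtain ⟨ρ, hρ, hρ2⟩ : ∃ ρ : ℝ, 0 < ρ ∧ ρ ^ 2 = v ⬝ᵥ v := by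
    have : 0 < v ⬝ᵥ v := by
      have h1 : 0 ≤ v ⬝ᵥ v := Finset.sum_nonneg fun i _ => mul_self_nonneg _
      exact lt_of_le_of_ne h1 fun h => hv0 (dotProduct_self_eq_zero.1 h.symm)
    exact ⟨√(v ⬝ᵥ v), Real.sqrt_pos.2 this, Real.sq_sqrt this.le⟩
  set w : Fin n → ℝ := ρ⁻¹ • (Uᵀ *ᵥ v) with hw
  have hUw : U *ᵥ w = ρ⁻¹ • v := by
    rw [hw, Matrix.mulVec_smul, Matrix.mulVec_mulVec, hU.orth', Matrix.one_mulVec]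
  have hww : w ⬝ᵥ w = 1 := by
    rw [hw, smul_dotProduct, dotProduct_smul, Matrix.dotProduct_mulVec, Matrix.vecMul_transpose,
      Matrix.mulVec_mulVec, hU.orth', Matrix.one_mulVec, ← hρ2]
    simp only [smul_eq_mul]
    field_simp
  have hlw : ∀ i, eig A i * w i = μ * w i := by
    have h1 : Matrix.diagonal (eig A) *ᵥ w = μ • w := by
      rw [hw, Matrix.mulVec_smul, Matrix.mulVec_mulVec, ← hU.transpose_mul, ← Matrix.mulVec_mulVec,
        hμ, Matrix.mulVec_smul, smul_comm]
    intro i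
    have := congrFun h1 i
    rwa [Matrix.mulVec_diagonal] at this
  obtain ⟨o, ho⟩ : ∃ o, w o ≠ 0 := by
    by_contra! h
    have : w = 0 := funext h
    rw [this] at hww
    simp at hww
  have hlo : eig A o = μ := mul_right_cancel₀ ho (hlw o)
  -- the reflection that exchanges `w` and the basis vector with index `o`
  set z : Fin n → ℝ := w - Pi.single o 1 with hz
  -- If w is already the basis vector then z = 0 and R is the identity.
  set c : ℝ := 2 / (z ⬝ᵥ z) with hc
  set R : Matrix (Fin n) (Fin n) ℝ := 1 - c • Matrix.vecMulVec z z with hR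
  have hzz : z ⬝ᵥ z = 2 - 2 * w o := by
    rw [hz, sub_dotProduct, dotProduct_sub, dotProduct_sub, hww]
    simp
    ring
  have hcz : c * (z ⬝ᵥ z) = 2 ∨ z = 0 := by
    by_cases h : z ⬝ᵥ z = 0
    · exact Or.inr (dotProduct_self_eq_zero.1 h)
    · exact Or.inl (div_mul_cancel₀ _ h)
  have hRt : Rᵀ = R := by
    rw [hR, Matrix.transpose_sub, Matrix.transpose_one, Matrix.transpose_smul,
      Matrix.transpose_vecMulVec]
  have hRR : R * R = 1 := by
    rcases hcz with h | h
    · have h1 : Matrix.vecMulVec z z * Matrix.vecMulVec z z =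
          (z ⬝ᵥ z) • Matrix.vecMulVec z z := by
        rw [Matrix.vecMulVec_mul_vecMulVec]
        ext i j
        simp [Matrix.vecMulVec_apply]
        ring
      simp only [hR, Matrix.sub_mul, Matrix.mul_sub, Matrix.one_mul, Matrix.mul_one,
        Matrix.smul_mul, Matrix.mul_smul, h1]
      ext i j
      simp only [Matrix.sub_apply, Matrix.smul_apply, smul_eq_mul]
      linear_combination (c * Matrix.vecMulVec z z i j) * h
    · rw [hR, h]; simp
  -- Both w and the basis vector lie in the μ-eigenspace of the diagonal matrix, hence so does z,
  -- and the reflection commutes with that matrix.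
  have hlz : ∀ i, eig A i * z i = μ * z i := by
    intro i
    by_cases h : i = o
    · subst h; rw [hlo]
    · simp [hz, h, hlw i]
  have hRD : R * Matrix.diagonal (eig A) = Matrix.diagonal (eig A) * R := by
    ext i j
    rw [Matrix.mul_diagonal, Matrix.diagonal_mul, hR, Matrix.sub_apply, Matrix.smul_apply,
      Matrix.vecMulVec_apply, sub_mul, mul_sub, smul_eq_mul]
    congr 1
    · by_cases h : i = j
      · subst h; ring
      · simp [h]
    · linear_combination c * z i * hlz j - c * z j * hlz i
  have hRo : R *ᵥ Pi.single o 1 = w := by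
    have h1 : z ⬝ᵥ Pi.single o 1 = w o - 1 := by simp [hz]
    rw [hR, Matrix.sub_mulVec, Matrix.one_mulVec, Matrix.smul_mulVec, Matrix.vecMulVec_mulVec, h1]
    rcases hcz with h | h
    · rw [hzz] at h
      ext i
      simp only [Pi.sub_apply, Pi.smul_apply, smul_eq_mul, MulOpposite.smul_eq_mul_unop,
        MulOpposite.unop_op]
      have : z i = w i - (Pi.single o 1 : Fin n → ℝ) i := rfl
      linear_combination this + (z i / 2) * h
    · rw [h]
      have : w = Pi.single o 1 := sub_eq_zero.1 (hz ▸ h)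
      simp [this]
  refine ⟨U * R, eig A, o, ρ, ⟨?_, ?_⟩, hρ, fun i => ?_, fun k => hlo ▸ hmin k⟩
  · rw [Matrix.transpose_mul, Matrix.mul_assoc, ← Matrix.mul_assoc Uᵀ, hU.orth, Matrix.one_mul,
      hRt, hRR]
  · rw [Matrix.transpose_mul, hRt, Matrix.mul_assoc U, hRD, ← Matrix.mul_assoc U,
      Matrix.mul_assoc _ R, ← Matrix.mul_assoc R, hRR, Matrix.one_mul, ← hU.eq]
  · have h1 : (U * R) *ᵥ Pi.single o 1 = ρ⁻¹ • v := by
      rw [← Matrix.mulVec_mulVec, hRo, hUw]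
    have h2 := congrFun h1 i
    rw [Matrix.mulVec_single_one] at h2
    have h3 : (U * R) i o = ρ⁻¹ * v i := h2
    rw [h3]
    field_simp

/-! ### The components of the derivatives in an eigenbasis -/

theorem conj_symUnit_diag (U : Matrix (Fin n) (Fin n) ℝ) (k j c : Fin n) :
    (Uᵀ * (symUnit k j : Matrix (Fin n) (Fin n) ℝ) * U) c c = U k c * U j c := by
  have h : ∀ a b : Fin n, (Uᵀ * Matrix.single a b (1 : ℝ) * U) c c = U a c * U b c := by
    intro a b
    rw [Matrix.mul_assoc, Matrix.mul_apply, Finset.sum_eq_single a]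
    · simp
    · intro i _ hi
      simp [hi]
    · simp
  simp only [symUnit, Matrix.mul_smul, Matrix.smul_mul, Matrix.mul_add, Matrix.add_mul,
    Matrix.smul_apply, Matrix.add_apply, h, smul_eq_mul]
  ring

theorem F1_eq (hf : ContDiffOn ℝ ∞ f (Gam n α)) (hs : SymmetricOn α f) {A : SymMat n}
    {U : Matrix (Fin n) (Fin n) ℝ} {l : Fin n → ℝ}
    (h : IsSpectral (A : Matrix (Fin n) (Fin n) ℝ) U l) (hl : l ∈ Gam n α) (k j : Fin n) :
    F1 f A k j = ∑ c, d1 f l c * (U k c * U j c) := by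
  unfold F1
  rw [(hasFDerivAt_matFun hf hs h hl).fderiv, IsSpectral.traceForm_apply ⟨h.orth, rfl⟩]
  exact Finset.sum_congr rfl fun c _ => by rw [conj_symUnit_diag]

theorem sum_F1_mul (hf : ContDiffOn ℝ ∞ f (Gam n α)) (hs : SymmetricOn α f) {A : SymMat n}
    {U : Matrix (Fin n) (Fin n) ℝ} {l : Fin n → ℝ}
    (h : IsSpectral (A : Matrix (Fin n) (Fin n) ℝ) U l) (hl : l ∈ Gam n α)
    (N : Matrix (Fin n) (Fin n) ℝ) :
    ∑ k, ∑ j, F1 f A k j * N k j = ∑ c, d1 f l c * (Uᵀ * N * U) c c := by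
  have h1 : ∀ c, (Uᵀ * N * U) c c = ∑ k, ∑ j, U k c * U j c * N k j := by
    intro c
    rw [Finset.sum_comm]
    simp only [Matrix.mul_apply, Matrix.transpose_apply, Finset.sum_mul]
    exact Finset.sum_congr rfl fun k _ => Finset.sum_congr rfl fun j _ => by ring
  simp only [F1_eq hf hs h hl, h1, Finset.sum_mul, Finset.mul_sum]
  rw [Finset.sum_comm' (t' := Finset.univ) (s' := fun _ => Finset.univ) (by simp)]
  rw [Finset.sum_comm]
  rw [Finset.sum_congr rfl fun k _ => Finset.sum_comm, Finset.sum_comm]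
  refine Finset.sum_congr rfl fun c _ => ?_
  refine Finset.sum_congr rfl fun k _ => Finset.sum_congr rfl fun j _ => ?_
  ring

theorem sum_smul_symUnit (B : SymMat n) :
    ∑ k, ∑ j, (B : Matrix (Fin n) (Fin n) ℝ) k j • symUnit k j = B := by
  apply Subtype.ext
  have hB : ∀ a b, (B : Matrix (Fin n) (Fin n) ℝ) a b = (B : Matrix (Fin n) (Fin n) ℝ) b a :=
    fun a b => congrFun (congrFun (show (B : Matrix (Fin n) (Fin n) ℝ)ᵀ = B from B.2) b) a
  ext a b
  simp only [AddSubmonoidClass.coe_finsetSum, Submodule.coe_smul, symUnit, Matrix.sum_apply,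
    Matrix.smul_apply, Matrix.add_apply, Matrix.single_apply, smul_eq_mul, mul_add, mul_ite,
    mul_one, mul_zero, Finset.sum_add_distrib, ite_and]
  simp
  rw [hB b a]
  ring

/-- The contraction `∑ F^{kl,pq} B_kl C_pq`. -/
def contr (F : Fin n → Fin n → Fin n → Fin n → ℝ) (B C : Fin n → Fin n → ℝ) : ℝ :=
  ∑ k, ∑ l, ∑ p, ∑ q, F k l p q * B k l * C p q

theorem contr_sum_left {ι : Type*} (s : Finset ι) (F : Fin n → Fin n → Fin n → Fin n → ℝ)
    (c : ι → ℝ) (T : ι → Fin n → Fin n → ℝ) (C : Fin n → Fin n → ℝ) :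
    contr F (fun k l => ∑ i ∈ s, c i * T i k l) C = ∑ i ∈ s, c i * contr F (T i) C := by
  classical
  induction s using Finset.induction_on with
  | empty => simp [contr]
  | insert i s hi ih =>
    rw [Finset.sum_insert hi, ← ih]
    simp only [contr, Finset.sum_insert hi, Finset.mul_sum, ← Finset.sum_add_distrib]
    refine Finset.sum_congr rfl fun k _ => Finset.sum_congr rfl fun l _ =>
      Finset.sum_congr rfl fun p _ => Finset.sum_congr rfl fun q _ => ?_
    rw [← Finset.mul_sum]
    ring

theorem contr_sum_right {ι : Type*} (s : Finset ι) (F : Fin n → Fin n → Fin n → Fin n → ℝ)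
    (c : ι → ℝ) (T : ι → Fin n → Fin n → ℝ) (B : Fin n → Fin n → ℝ) :
    contr F B (fun k l => ∑ i ∈ s, c i * T i k l) = ∑ i ∈ s, c i * contr F B (T i) := by
  classical
  induction s using Finset.induction_on with
  | empty => simp [contr]
  | insert i s hi ih =>
    rw [Finset.sum_insert hi, ← ih]
    simp only [contr, Finset.sum_insert hi, Finset.mul_sum, ← Finset.sum_add_distrib]
    refine Finset.sum_congr rfl fun k _ => Finset.sum_congr rfl fun l _ =>
      Finset.sum_congr rfl fun p _ => Finset.sum_congr rfl fun q _ => ?_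
    rw [← Finset.mul_sum]
    ring

theorem apply_sum_symUnit (D : SymMat n →L[ℝ] SymMat n →L[ℝ] ℝ) (B C : SymMat n) :
    contr (fun k l p q => D (symUnit k l) (symUnit p q)) (B : Matrix (Fin n) (Fin n) ℝ)
      (C : Matrix (Fin n) (Fin n) ℝ) = D B C := by
  have h1 : ∀ L : SymMat n →L[ℝ] ℝ,
      ∑ p, ∑ q, (C : Matrix (Fin n) (Fin n) ℝ) p q * L (symUnit p q) = L C := by
    intro L
    conv_rhs => rw [← sum_smul_symUnit C]
    simp only [map_sum, map_smul, smul_eq_mul]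
  conv_rhs => rw [← sum_smul_symUnit B]
  simp only [map_sum, map_smul, sum_apply, smul_apply, smul_eq_mul, contr]
  refine Finset.sum_congr rfl fun k _ => Finset.sum_congr rfl fun l _ => ?_
  simp only [← h1, Finset.mul_sum]
  exact Finset.sum_congr rfl fun p _ => Finset.sum_congr rfl fun q _ => by ring

theorem contr_F2 (hf : ContDiffOn ℝ ∞ f (Gam n α)) (hs : SymmetricOn α f) {A : SymMat n}
    {U : Matrix (Fin n) (Fin n) ℝ} {l : Fin n → ℝ}
    (h : IsSpectral (A : Matrix (Fin n) (Fin n) ℝ) U l) (hl : l ∈ Gam n α) (B : SymMat n) :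
    contr (F2 f A) (B : Matrix (Fin n) (Fin n) ℝ) (B : Matrix (Fin n) (Fin n) ℝ) =
      specQuad (d2 f l) (offCoef f l) (Uᵀ * (B : Matrix (Fin n) (Fin n) ℝ) * U) := by
  obtain ⟨D, hD, hD'⟩ := exists_hasFDerivAt_fderiv_matFun hf hs h hl
  rw [← hD', ← apply_sum_symUnit D B B]
  have : F2 f A = fun k l p q => D (symUnit k l) (symUnit p q) := by
    funext k l p q
    unfold F2
    rw [hD.fderiv]
  rw [this]

/-! ### The tensor `T` in an eigenbasis -/

/-- The components of `T` in the basis of the columns of `U`. -/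
def conjTensor (U : Matrix (Fin n) (Fin n) ℝ) (T : Fin n → Fin n → Fin n → ℝ) (a b c : Fin n) : ℝ :=
  ∑ i, ∑ j, ∑ k, U i a * U j b * U k c * T i j k

theorem conjTensor_totallySymmetric (U : Matrix (Fin n) (Fin n) ℝ)
    {T : Fin n → Fin n → Fin n → ℝ} (hT : TotallySymmetric T) :
    TotallySymmetric (conjTensor U T) := by
  intro a b c
  constructor
  · unfold conjTensor
    rw [Finset.sum_comm]
    refine Finset.sum_congr rfl fun i _ => Finset.sum_congr rfl fun j _ =>
      Finset.sum_congr rfl fun k _ => ?_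
    rw [(hT j i k).1]; ring
  · unfold conjTensor
    refine Finset.sum_congr rfl fun i _ => ?_
    rw [Finset.sum_comm]
    refine Finset.sum_congr rfl fun j _ => Finset.sum_congr rfl fun k _ => ?_
    rw [(hT i k j).2]; ring

/-- The slice `∑ i, c i T_i` as a symmetric matrix. -/
def tensorSlice {T : Fin n → Fin n → Fin n → ℝ} (hT : TotallySymmetric T) (c : Fin n → ℝ) :
    SymMat n :=
  ⟨Matrix.of fun k l => ∑ i, c i * T i k l, by
    change (Matrix.of fun k l => ∑ i, c i * T i k l)ᵀ = _
    ext k l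
    rw [Matrix.transpose_apply, Matrix.of_apply, Matrix.of_apply]
    exact Finset.sum_congr rfl fun i _ => by rw [(hT i l k).2]⟩

theorem conj_tensorSlice (U : Matrix (Fin n) (Fin n) ℝ) {T : Fin n → Fin n → Fin n → ℝ}
    (hT : TotallySymmetric T) (a b c : Fin n) :
    (Uᵀ * (tensorSlice hT fun i => U i a : Matrix (Fin n) (Fin n) ℝ) * U) b c =
      conjTensor U T a b c := by
  simp only [tensorSlice, Matrix.mul_apply, Matrix.transpose_apply, Matrix.of_apply, conjTensor,
    Finset.sum_mul, Finset.mul_sum]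
  rw [Finset.sum_comm, Finset.sum_congr rfl fun j _ => Finset.sum_comm, Finset.sum_comm]
  refine Finset.sum_congr rfl fun i _ => Finset.sum_congr rfl fun j _ =>
    Finset.sum_congr rfl fun k _ => ?_
  ring

theorem sum_conjTensor_diag {U : Matrix (Fin n) (Fin n) ℝ} (hU : Uᵀ * U = 1)
    (T : Fin n → Fin n → Fin n → ℝ) (a : Fin n) :
    ∑ b, conjTensor U T a b b = ∑ i, U i a * ∑ j, T i j j := by
  have hU' : U * Uᵀ = 1 := mul_eq_one_comm.1 hU
  have h1 : ∀ j k, ∑ b, U j b * U k b = if j = k then 1 else 0 := by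
    intro j k
    have := congrFun (congrFun hU' j) k
    rwa [Matrix.mul_apply, Matrix.one_apply] at this
  unfold conjTensor
  rw [Finset.sum_comm]
  refine Finset.sum_congr rfl fun i _ => ?_
  rw [Finset.sum_comm, Finset.mul_sum]
  refine Finset.sum_congr rfl fun j _ => ?_
  rw [Finset.sum_comm]
  have h2 : ∀ k, ∑ b, U i a * U j b * U k b * T i j k =
      if j = k then U i a * T i j k else 0 := by
    intro k
    have : ∀ b, U i a * U j b * U k b * T i j k = (U j b * U k b) * (U i a * T i j k) :=
      fun b => by ring
    simp only [this, ← Finset.sum_mul, h1, ite_mul, one_mul, zero_mul]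
  simp only [h2, Finset.sum_ite_eq, Finset.mem_univ, if_true]

/-! ### `β` in an eigenbasis -/

theorem IsSpectral.shifted {A : SymMat n} {U : Matrix (Fin n) (Fin n) ℝ} {l : Fin n → ℝ}
    (h : IsSpectral (A : Matrix (Fin n) (Fin n) ℝ) U l) :
    IsSpectral (shifted α A) U (fun k => l k - α) := by
  refine ⟨h.orth, ?_⟩
  have h1 : Matrix.diagonal (fun k => l k - α) =
      Matrix.diagonal l - α • (1 : Matrix (Fin n) (Fin n) ℝ) := by
    rw [Matrix.smul_one_eq_diagonal, Matrix.diagonal_sub]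
  rw [h1, Matrix.mul_sub, Matrix.sub_mul, ← h.eq, Matrix.mul_smul, Matrix.mul_one,
    Matrix.smul_mul, h.orth']
  rfl

theorem sum_column_mul {U : Matrix (Fin n) (Fin n) ℝ} (hU : Uᵀ * U = 1) (a o : Fin n) :
    ∑ p, U p a * U p o = if a = o then 1 else 0 := by
  have := congrFun (congrFun hU a) o
  rwa [Matrix.mul_apply, Matrix.one_apply] at this

theorem sum_sq_column {U : Matrix (Fin n) (Fin n) ℝ} (hU : Uᵀ * U = 1) {v : Fin n → ℝ} {o : Fin n}
    {ρ : ℝ} (hv : ∀ i, v i = ρ * U i o) : ∑ i, v i ^ 2 = ρ ^ 2 := by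
  have h1 := sum_column_mul hU o o
  rw [if_pos rfl] at h1
  simp only [hv]
  rw [← mul_one (ρ ^ 2), ← h1, Finset.mul_sum]
  exact Finset.sum_congr rfl fun i _ => by ring

theorem eps_eq {A : SymMat n} {U : Matrix (Fin n) (Fin n) ℝ} {l : Fin n → ℝ} {v : Fin n → ℝ}
    {o : Fin n} {ρ : ℝ} (h : IsSpectral (A : Matrix (Fin n) (Fin n) ℝ) U l) (hρ : 0 < ρ)
    (hv : ∀ i, v i = ρ * U i o) : eps α A v = (l o - α) / ∑ k, (l k - α) := by
  have hs := h.shifted (α := α)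
  have h2 : ∑ i, ∑ j, shifted α A i j * v i * v j = ρ ^ 2 * (l o - α) := by
    have h3 : (Uᵀ * shifted α A * U) o o = l o - α := by
      rw [hs.transpose_mul, Matrix.mul_assoc, hs.orth, Matrix.mul_one, Matrix.diagonal_apply_eq]
    rw [← h3, Matrix.mul_apply, Finset.sum_comm, Finset.mul_sum]
    refine Finset.sum_congr rfl fun j _ => ?_
    rw [Matrix.mul_apply, Finset.sum_mul, Finset.mul_sum]
    refine Finset.sum_congr rfl fun i _ => ?_
    rw [hv, hv, Matrix.transpose_apply]
    ring
  unfold eps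
  rw [h2, sum_sq_column h.orth hv, hs.trace_eq, mul_comm (ρ ^ 2), mul_div_mul_right _ _ (by positivity)]

/-- With Γ scaled by ρ, the linear term (one factor v) and the quadratic term both scale by ρ². -/
theorem gammaTerm_eq (hf : ContDiffOn ℝ ∞ f (Gam n α)) (hs : SymmetricOn α f) {A : SymMat n}
    {U : Matrix (Fin n) (Fin n) ℝ} {l : Fin n → ℝ}
    (h : IsSpectral (A : Matrix (Fin n) (Fin n) ℝ) U l) (hl : l ∈ Gam n α) {v : Fin n → ℝ}
    {o : Fin n} {ρ : ℝ} (hv : ∀ i, v i = ρ * U i o)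
    (hε : eps α A v * ∑ k, (l k - α) = l o - α) (T : Fin n → Fin n → Fin n → ℝ)
    (g : Fin n → Fin n → ℝ) :
    gammaTerm α f A v T (ρ • (U * Matrix.of g * Uᵀ)) =
      ρ ^ 2 * specGamma o (eps α A v) (fun k => l k - α) (d1 f l) (conjTensor U T) g := by
  obtain ⟨ε, hεdef⟩ : ∃ ε, ε = eps α A v := ⟨_, rfl⟩
  obtain ⟨G, hG⟩ : ∃ G : Matrix (Fin n) (Fin n) ℝ, G = ρ • (U * Matrix.of g * Uᵀ) := ⟨_, rfl⟩
  obtain ⟨W, hW⟩ : ∃ W : Matrix (Fin n) (Fin n) ℝ, W = Matrix.of fun j p =>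
    (∑ i, T j p i * v i) - ε * (∑ a, T j a a) * v p := ⟨_, rfl⟩
  obtain ⟨Z, hZ⟩ : ∃ Z : Matrix (Fin n) (Fin n) ℝ, Z =
    shifted α A - (ε * (shifted α A).trace) • (1 : Matrix (Fin n) (Fin n) ℝ) := ⟨_, rfl⟩
  have hsh := h.shifted (α := α)
  have hUGt : Uᵀ * Gᵀ = ρ • ((Matrix.of g)ᵀ * Uᵀ) := by
    rw [hG, Matrix.transpose_smul, Matrix.transpose_mul, Matrix.transpose_mul,
      Matrix.transpose_transpose, Matrix.mul_smul, ← Matrix.mul_assoc, h.orth, Matrix.one_mul]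
  have hGU : G * U = ρ • (U * Matrix.of g) := by
    rw [hG, Matrix.smul_mul, Matrix.mul_assoc, h.orth, Matrix.mul_one]
  -- Since ε tr Ã = l_o - α, the quadratic form is diagonal with entries l_k - l_o and degenerates
  -- exactly on the smallest eigenvalue.
  have hUZU : Uᵀ * Z * U = Matrix.diagonal fun k => l k - l o := by
    rw [hZ, Matrix.mul_sub, Matrix.sub_mul, hsh.transpose_mul, Matrix.mul_assoc, h.orth,
      Matrix.mul_one, Matrix.mul_smul, Matrix.smul_mul, Matrix.mul_one, h.orth, hsh.trace_eq,
      hεdef, hε, Matrix.smul_one_eq_diagonal, Matrix.diagonal_sub]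
    congr 1
    ext k
    ring
  have hUWU : ∀ a c, (Uᵀ * Wᵀ * U) a c = ρ * (conjTensor U T c a o -
      ε * (∑ b, conjTensor U T c b b) * if a = o then 1 else 0) := by
    intro a c
    have e1 : (Uᵀ * Wᵀ * U) a c = ∑ j, ∑ p, U j c * U p a * W j p := by
      rw [Matrix.mul_apply]
      refine Finset.sum_congr rfl fun j _ => ?_
      rw [Matrix.mul_apply, Finset.sum_mul]
      refine Finset.sum_congr rfl fun p _ => ?_
      rw [Matrix.transpose_apply, Matrix.transpose_apply]
      ring
    have e2 : ∑ j, ∑ p, U j c * U p a * (∑ i, T j p i * v i) = ρ * conjTensor U T c a o := by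
      simp only [conjTensor, Finset.mul_sum]
      refine Finset.sum_congr rfl fun j _ => Finset.sum_congr rfl fun p _ =>
        Finset.sum_congr rfl fun i _ => ?_
      rw [hv]; ring
    have e3 : ∑ j, ∑ p, U j c * U p a * (ε * (∑ a, T j a a) * v p) =
        ρ * (ε * (∑ b, conjTensor U T c b b) * if a = o then 1 else 0) := by
      have e4 : ∀ j, ∑ p, U j c * U p a * (ε * (∑ a, T j a a) * v p) =
          U j c * (∑ a, T j a a) * (ρ * ε * if a = o then 1 else 0) := by
        intro j
        generalize ∑ a, T j a a = t
        rw [← sum_column_mul h.orth, Finset.mul_sum, Finset.mul_sum]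
        refine Finset.sum_congr rfl fun p _ => ?_
        rw [hv]; ring
      rw [sum_conjTensor_diag h.orth, Finset.sum_congr rfl fun j _ => e4 j, ← Finset.sum_mul]
      ring
    rw [e1, mul_sub, ← e2, ← e3, ← Finset.sum_sub_distrib]
    refine Finset.sum_congr rfl fun j _ => ?_
    rw [← Finset.sum_sub_distrib]
    refine Finset.sum_congr rfl fun p _ => ?_
    rw [hW, Matrix.of_apply]
    ring
  have hN : gammaTerm α f A v T G =
      ∑ k, ∑ j, F1 f A k j * ((2 : ℝ) • (Gᵀ * Wᵀ) - Gᵀ * Z * G) k j := by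
    unfold gammaTerm
    refine Finset.sum_congr rfl fun k _ => Finset.sum_congr rfl fun j _ => ?_
    congr 1
    rw [Matrix.sub_apply, Matrix.smul_apply, smul_eq_mul, Matrix.mul_apply, Matrix.mul_apply]
    congr 1
    · simp only [hW, Matrix.transpose_apply, Matrix.of_apply, hεdef]
    · rw [Finset.sum_comm]
      refine Finset.sum_congr rfl fun q _ => ?_
      rw [Matrix.mul_apply, Finset.sum_mul]
      refine Finset.sum_congr rfl fun p _ => ?_
      rw [hZ, Matrix.sub_apply, Matrix.smul_apply, smul_eq_mul, Matrix.transpose_apply, hεdef]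
      ring
  rw [← hG, hN, sum_F1_mul hf hs h hl, specGamma, Finset.mul_sum, ← hεdef]
  refine Finset.sum_congr rfl fun c _ => ?_
  have e1 : Uᵀ * ((2 : ℝ) • (Gᵀ * Wᵀ) - Gᵀ * Z * G) * U =
      (2 * ρ) • ((Matrix.of g)ᵀ * (Uᵀ * Wᵀ * U)) -
        ρ ^ 2 • ((Matrix.of g)ᵀ * (Uᵀ * Z * U) * Matrix.of g) := by
    have e2 : Uᵀ * (Gᵀ * Wᵀ) * U = ρ • ((Matrix.of g)ᵀ * (Uᵀ * Wᵀ * U)) := by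
      rw [← Matrix.mul_assoc, hUGt, Matrix.smul_mul, Matrix.smul_mul]
      simp only [Matrix.mul_assoc]
    have e3 : Uᵀ * (Gᵀ * Z * G) * U =
        ρ ^ 2 • ((Matrix.of g)ᵀ * (Uᵀ * Z * U) * Matrix.of g) := by
      have : Uᵀ * (Gᵀ * Z * G) * U = (Uᵀ * Gᵀ) * Z * (G * U) := by simp only [Matrix.mul_assoc]
      rw [this, hUGt, hGU, Matrix.smul_mul, Matrix.smul_mul, Matrix.mul_smul, smul_smul, sq]
      simp only [Matrix.mul_assoc]
    rw [Matrix.mul_sub, Matrix.sub_mul, Matrix.mul_smul, Matrix.smul_mul, e2, e3, smul_smul]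
  rw [e1, hUZU, Matrix.sub_apply, Matrix.smul_apply, Matrix.smul_apply, Matrix.mul_apply,
    Matrix.mul_apply, smul_eq_mul, smul_eq_mul, Finset.mul_sum, Finset.mul_sum,
    ← Finset.sum_sub_distrib, Finset.mul_sum, Finset.mul_sum, Finset.mul_sum]
  refine Finset.sum_congr rfl fun a _ => ?_
  rw [Matrix.mul_diagonal, Matrix.transpose_apply, Matrix.of_apply, hUWU]
  ring

theorem sum_F2_slice (hf : ContDiffOn ℝ ∞ f (Gam n α)) (hs : SymmetricOn α f) {A : SymMat n}
    {U : Matrix (Fin n) (Fin n) ℝ} {l : Fin n → ℝ}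
    (h : IsSpectral (A : Matrix (Fin n) (Fin n) ℝ) U l) (hl : l ∈ Gam n α)
    {T : Fin n → Fin n → Fin n → ℝ} (hT : TotallySymmetric T) (a : Fin n) :
    ∑ i, ∑ j, U i a * U j a * contr (F2 f A) (T i) (T j) =
      specQuad (d2 f l) (offCoef f l) (conjTensor U T a) := by
  have h1 := contr_F2 hf hs h hl (tensorSlice hT fun i => U i a)
  have h2 : (Uᵀ * (tensorSlice hT fun i => U i a : Matrix (Fin n) (Fin n) ℝ) * U :
      Fin n → Fin n → ℝ) = conjTensor U T a := by
    funext b c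
    exact conj_tensorSlice U hT a b c
  have h3 : ((tensorSlice hT fun i => U i a : Matrix (Fin n) (Fin n) ℝ) : Fin n → Fin n → ℝ) =
      fun k l => ∑ i, U i a * T i k l := rfl
  rw [h2, h3, contr_sum_left] at h1
  rw [← h1]
  refine Finset.sum_congr rfl fun i _ => ?_
  rw [contr_sum_right, Finset.mul_sum]
  exact Finset.sum_congr rfl fun j _ => by ring

/-- A single array Γ bounds the supremum from below, so no case distinction in the extended reals is
needed. -/
theorem beta_nonneg_of_exists {A : SymMat n} {v : Fin n → ℝ} {T : Fin n → Fin n → Fin n → ℝ}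
    (G : Fin n → Fin n → ℝ)
    (hG : 0 ≤ (∑ i, ∑ j, v i * v j * contr (F2 f A) (T i) (T j))
      - eps α A v * (∑ i, v i ^ 2) * (∑ a, contr (F2 f A) (T a) (T a))
      + 2 * gammaTerm α f A v T G) :
    0 ≤ beta α f A v T := by
  have e1 : ∑ i, ∑ j, ∑ k, ∑ l, ∑ p, ∑ q, v i * v j * F2 f A k l p q * T i k l * T j p q =
      ∑ i, ∑ j, v i * v j * contr (F2 f A) (T i) (T j) := by
    refine Finset.sum_congr rfl fun i _ => Finset.sum_congr rfl fun j _ => ?_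
    simp only [contr, Finset.mul_sum]
    refine Finset.sum_congr rfl fun k _ => Finset.sum_congr rfl fun l _ =>
      Finset.sum_congr rfl fun p _ => Finset.sum_congr rfl fun q _ => ?_
    ring
  unfold beta
  rw [e1]
  have h1 : ((gammaTerm α f A v T G : ℝ) : EReal) ≤
      ⨆ G : Fin n → Fin n → ℝ, ((gammaTerm α f A v T G : ℝ) : EReal) :=
    le_iSup (fun G : Fin n → Fin n → ℝ => ((gammaTerm α f A v T G : ℝ) : EReal)) G
  have h2 : (2 : EReal) * ((gammaTerm α f A v T G : ℝ) : EReal) ≤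
      2 * ⨆ G : Fin n → Fin n → ℝ, ((gammaTerm α f A v T G : ℝ) : EReal) :=
    mul_le_mul_of_nonneg_left h1 zero_le_two
  refine le_trans ?_ (add_le_add le_rfl h2)
  have h3 := EReal.coe_nonneg.2 hG
  rw [EReal.coe_add, EReal.coe_mul] at h3
  exact h3

end CurvaturePinching

end

/-! ### Conclusion in an eigenbasis containing v/|v|. -/

theorem theorem4p3 {n : ℕ} (α σ : ℝ) (hσ : 0 ≤ σ) (hσα : σ ≤ α)
    (f : (Fin n → ℝ) → ℝ)
    (hsmooth : ContDiffOn ℝ ∞ f (CurvaturePinching.Gam n α))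
    (hsymm : CurvaturePinching.SymmetricOn α f)
    (hmono : MonotoneOn f (CurvaturePinching.Gam n α))
    (hconc : ConcaveOn ℝ (CurvaturePinching.Gam n α) f)
    (hinv : CurvaturePinching.InverseConcaveOn α σ f)
    (A : CurvaturePinching.SymMat n)
    (hA : CurvaturePinching.eig A ∈ CurvaturePinching.Gam n α)
    (v : Fin n → ℝ) (hv : CurvaturePinching.IsMinEigenvector A v)
    (T : Fin n → Fin n → Fin n → ℝ) (hT : CurvaturePinching.TotallySymmetric T)
    (hTv : ∀ k, ∑ i, ∑ j, T i j k * v i * v j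
      = CurvaturePinching.eps α A v * ∑ i, T i i k) :
    (0 < CurvaturePinching.eps α A v ∧ CurvaturePinching.eps α A v ≤ 1 / (n : ℝ) ∧
      (CurvaturePinching.eps α A v = 1 / (n : ℝ) →
        ∃ c : ℝ, (A : Matrix (Fin n) (Fin n) ℝ) = c • (1 : Matrix (Fin n) (Fin n) ℝ))) ∧
    0 ≤ CurvaturePinching.beta α f A v T := by
  open CurvaturePinching in
  obtain ⟨U, l, o, ρ, h, hρ, hvU, ho⟩ := exists_isSpectral_min hv
  have hl : l ∈ Gam n α := h.mem_Gam.2 hA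
  have hx : ∀ k, 0 < l k - α := fun k => sub_pos.2 (hl k)
  have hS : 0 < ∑ k, (l k - α) := Finset.sum_pos (fun k _ => hx k) ⟨o, Finset.mem_univ o⟩
  have heps : eps α A v = (l o - α) / ∑ k, (l k - α) := eps_eq h hρ hvU
  have hn : 0 < (n : ℝ) := Nat.cast_pos.2 o.pos
  have hε : eps α A v * ∑ k, (l k - α) = l o - α := by rw [heps, div_mul_cancel₀ _ hS.ne']
  have hε0 : 0 < eps α A v := by rw [heps]; exact div_pos (hx o) hS
  have hsum : (n : ℝ) * (l o - α) ≤ ∑ k, (l k - α) := by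
    have := Finset.sum_le_sum fun k (_ : k ∈ Finset.univ) => sub_le_sub_right (ho k) α
    rw [Finset.sum_const, Finset.card_univ, Fintype.card_fin, nsmul_eq_mul] at this
    exact this
  have hεn : eps α A v ≤ 1 / (n : ℝ) := by
    rw [heps, div_le_div_iff₀ hS hn]
    linarith
  have hε1 : eps α A v ≤ 1 := by
    refine hεn.trans ?_
    rw [div_le_one hn]
    exact_mod_cast o.pos
  refine ⟨⟨hε0, hεn, fun heq => ⟨l o, ?_⟩⟩, ?_⟩
  · have h1 : ∑ k, (l k - l o) = 0 := by
      rw [heps, div_eq_div_iff hS.ne' hn.ne'] at heq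
      have h2 : ∑ k, (l k - α) = ∑ k, l k - n * α := by simp
      have h3 : ∑ k, (l k - l o) = ∑ k, l k - n * l o := by simp
      linarith
    rw [Finset.sum_eq_zero_iff_of_nonneg fun k _ => sub_nonneg.2 (ho k)] at h1
    have h2 : l = fun _ => l o := funext fun k => sub_eq_zero.1 (h1 k (Finset.mem_univ k))
    have h3 : Matrix.diagonal l = l o • (1 : Matrix (Fin n) (Fin n) ℝ) := by
      conv_lhs => rw [h2]
      rw [Matrix.smul_one_eq_diagonal]
    rw [h.eq, h3, Matrix.mul_smul, Matrix.mul_one, Matrix.smul_mul, h.orth']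
  · obtain ⟨g, hg⟩ := exists_spec_nonneg hσα hsmooth hsymm hmono hconc hinv hl ho
      (conjTensor_totallySymmetric U hT) hε hε0.le hε1
    refine beta_nonneg_of_exists (ρ • (U * Matrix.of g * Uᵀ)) ?_
    rw [gammaTerm_eq hsmooth hsymm h hl hvU hε]
    have e1 : ∑ i, ∑ j, v i * v j * contr (F2 f A) (T i) (T j) =
        ρ ^ 2 * specQuad (d2 f l) (offCoef f l) (conjTensor U T o) := by
      rw [← sum_F2_slice hsmooth hsymm h hl hT o, Finset.mul_sum]
      refine Finset.sum_congr rfl fun i _ => ?_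
      rw [Finset.mul_sum]
      refine Finset.sum_congr rfl fun j _ => ?_
      rw [hvU, hvU]
      ring
    -- The trace over the first slot of T is the same in every orthonormal basis, by U Uᵀ = 1.
    have e2 : ∑ a, contr (F2 f A) (T a) (T a) =
        ∑ a, specQuad (d2 f l) (offCoef f l) (conjTensor U T a) := by
      have hU' : ∀ i j, ∑ a, U i a * U j a = if i = j then 1 else 0 := fun i j => by
        have := congrFun (congrFun h.orth' i) j
        rwa [Matrix.mul_apply, Matrix.one_apply] at this
      simp only [← sum_F2_slice hsmooth hsymm h hl hT]
      rw [Finset.sum_comm]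
      refine Finset.sum_congr rfl fun i _ => ?_
      rw [Finset.sum_comm]
      simp only [← Finset.sum_mul, hU', ite_mul, one_mul, zero_mul, Finset.sum_ite_eq,
        Finset.mem_univ, if_true]
    rw [e1, e2, sum_sq_column h.orth hvU]
    have := mul_nonneg (sq_nonneg ρ) hg
    linarith
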